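/- Let $n\ge 2$ and let $E,F$ be vector bundles on $\mathbb{P}^n=\mathbb{P}^n_{\mathbb{C}}$ such that $\mathrm{Hom}(E,E)=\mathrm{Hom}(F,F)=\mathbb{C}$, $\mathrm{Hom}(F,E)=0$, $\mathrm{Ext}^1(F,E)=0$, the sheaf $E^*\otimes F$ is globally generated, and $w=\dim\mathrm{Hom}(E,F)\ge 3$. Let $\sigma=(\sigma_1,\dots,\sigma_w)$ be any basis of $\mathrm{Hom}(E,F)$. Let $K_w$ be the Kronecker quiver with two vertices and $w$ arrows from the first to the second. Its representations $A=(V,W,(A_i)_{i=1}^w)$ consist of finite-dimensional complex vector spaces $V,W$ and linear maps $A_i:V\to W$; a morphism $A\to B$ is a pair of linear maps $(f_1,f_2)$ with $f_2A_i=B_if_1$ for all $i$. Call $A$ $(E,F,\sigma)$-globally injective if for every point $P\in\mathbb{P}^n$ the map on fibres $\sum_i A_i\otimes\sigma_i(P):V\otimes E_P\to W\otimes F_P$ is injective. Let $L_\sigma$ be the functor sending $A$ to $\mathrm{coker}\bigl(\sum_i A_i\otimes\sigma_i: V\otimes E\to W\otimes F\bigr)$ and a morphism $(f_1,f_2)$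 to the map of cokernels induced by $f_1\otimes 1_E$ and $f_2\otimes 1_F$. Then: (a) $L_\sigma$ is an equivalence from the full subcategory of $(E,F,\sigma)$-globally injective representations of $K_w$ to the full subcategory of sheaves of modules on $\mathbb{P}^n$ consisting of the vector bundles $C$ that admit an exact sequence $0\to E^{a}\to F^{b}\to C\to 0$ for some $a,b\in\mathbb{N}$. (b) $L_\sigma$ is an equivalence from the full subcategory of $(E,F,\sigma)$-globally injective representations with $\dim W\cdot\mathrm{rk}\,F-\dim V\cdot\mathrm{rk}\,E\ge n$ to the full subcategory of cokernel bundles of type $(E,F)$, i.e. of vector bundles $C$ that admit an exact sequence $0\to E^{a}\to F^{b}\to C\to 0$ with $a,b\in\mathbb{N}$ and $b\,\mathrm{rk}\,F-a\,\mathrm{rk}\,E\ge n$. -/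

import Mathlib

open CategoryTheory Limits AlgebraicGeometry TopologicalSpace Opposite

open scoped TensorProduct

noncomputable section

namespace CokernelBundles

section ProjectiveSpace

attribute [local instance] MvPolynomial.gradedAlgebra

/-- Projective space `ℙⁿ` over `ℂ`, i.e. `Proj ℂ[x₀, …, xₙ]`. -/
def PSpace (n : ℕ) : Scheme.{0} :=
  Proj (MvPolynomial.homogeneousSubmodule (Fin (n + 1)) ℂ)

/-- The structure morphism `ℙⁿ ⟶ Spec ℂ`. -/
def PSpace.toSpec (n : ℕ) : PSpace n ⟶ Spec (.of ℂ) :=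
  Proj.toSpecZero (MvPolynomial.homogeneousSubmodule (Fin (n + 1)) ℂ) ≫
    Spec.map (CommRingCat.ofHom
      (algebraMap ℂ (MvPolynomial.homogeneousSubmodule (Fin (n + 1)) ℂ 0)))

end ProjectiveSpace

section Scalars

variable {n : ℕ}

/-- Complex numbers as (constant) regular functions on an open subset of `ℙⁿ`. -/
def const (U : (PSpace n).Opens) : ℂ →+* Γ(PSpace n, U) :=
  ((Scheme.ΓSpecIso (.of ℂ)).inv ≫ (PSpace.toSpec n).appLE ⊤ U le_top).hom

theorem const_map {U V : (PSpace n).Opens} (i : V ⟶ U) (c : ℂ) :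
    (PSpace n).presheaf.map i.op (const U c) = const V c := by
  have h := Scheme.Hom.appLE_map (PSpace.toSpec n) (U := ⊤) (V := U) le_top i.op
  have := congr(($h).hom ((Scheme.ΓSpecIso (.of ℂ)).inv.hom c))
  simpa [const] using this

/-- Multiplication by a complex number, as an endomorphism of an `𝒪`-module on `ℙⁿ`. -/
def scalarEnd (M : (PSpace n).Modules) (c : ℂ) : M ⟶ M :=
  ⟨PresheafOfModules.homMk
    { app := fun U => M.smul (const U.unop c)
      naturality := fun U V f => by
        have := Scheme.Modules.map_comp_smul (M := M) f.unop (const U.unop c)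
        rw [const_map] at this
        exact this.symm }
    (fun U r m => smul_comm (M := Γ(PSpace n, U.unop)) (N := Γ(PSpace n, U.unop))
        (α := Γ(M, U.unop)) (const U.unop c) r m)⟩

theorem scalarEnd_app (M : (PSpace n).Modules) (c : ℂ) (U : (PSpace n).Opens) (m : Γ(M, U)) :
    (scalarEnd M c).app U m = const U c • m := rfl

theorem scalarEnd_comp {M N : (PSpace n).Modules} (φ : M ⟶ N) (c : ℂ) :
    scalarEnd M c ≫ φ = φ ≫ scalarEnd N c := by
  ext U m
  exact φ.app_smul (const U c) m

/-- Morphisms of `𝒪`-modules on `ℙⁿ` form a `ℂ`-vector space: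
`(c • φ)(s) = c • φ(s)` for all local sections `s`. -/
instance homModule (M N : (PSpace n).Modules) : Module ℂ (M ⟶ N) where
  smul c φ := φ ≫ scalarEnd N c
  one_smul φ := by
    change φ ≫ scalarEnd N 1 = φ
    ext U m
    change const U 1 • φ.app U m = φ.app U m
    rw [map_one, one_smul]
  mul_smul c d φ := by
    change φ ≫ scalarEnd N (c * d) = (φ ≫ scalarEnd N d) ≫ scalarEnd N c
    ext U m
    change const U (c * d) • φ.app U m = const U c • const U d • φ.app U m
    rw [map_mul, mul_smul]
  smul_zero c := zero_comp
  smul_add c φ ψ := Preadditive.add_comp _ _ _ _ _ _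
  add_smul c d φ := by
    change φ ≫ scalarEnd N (c + d) = φ ≫ scalarEnd N c + φ ≫ scalarEnd N d
    ext U m
    change const U (c + d) • φ.app U m = const U c • φ.app U m + const U d • φ.app U m
    rw [map_add, add_smul]
  zero_smul φ := by
    change φ ≫ scalarEnd N 0 = 0
    ext U m
    change const U 0 • φ.app U m = 0
    rw [map_zero, zero_smul]

theorem smul_def {M N : (PSpace n).Modules} (c : ℂ) (φ : M ⟶ N) :
    c • φ = φ ≫ scalarEnd N c := rfl

/-- The category of `𝒪`-modules on `ℙⁿ` is `ℂ`-linear. -/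
instance : Linear ℂ (PSpace n).Modules where
  homModule := homModule
  smul_comp _ _ _ c φ ψ := by
    rw [smul_def, smul_def, Category.assoc, Category.assoc, scalarEnd_comp]
  comp_smul _ _ _ φ c ψ := by
    rw [smul_def, smul_def, Category.assoc]

end Scalars

section Fibres

variable {n : ℕ}

/-- Complex numbers as elements of a local ring of `ℙⁿ`. -/
def constStalk (x : PSpace n) : ℂ →+* (PSpace n).presheaf.stalk x :=
  ((PSpace n).presheaf.germ ⊤ x trivial).hom.comp (const ⊤)

/-- The stalk of an `𝒪`-module at a point. -/
def Stalk (M : (PSpace n).Modules) (x : PSpace n) : Type :=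
  (TopCat.Presheaf.stalk (C := Ab) M.presheaf x : Ab)

instance (M : (PSpace n).Modules) (x : PSpace n) : AddCommGroup (Stalk M x) :=
  inferInstanceAs (AddCommGroup (TopCat.Presheaf.stalk (C := Ab) M.presheaf x : Ab))

/-- The stalk `M_x` is a module over the local ring `𝒪_x`. -/
instance (M : (PSpace n).Modules) (x : PSpace n) :
    Module ((PSpace n).presheaf.stalk x) (Stalk M x) :=
  PresheafOfModules.instModuleCarrierStalkCommRingCatCarrierAbPresheafOpensCarrier
    (R := (PSpace n).presheaf) M.val x

/-- The germ at `x` of a section of `M`. -/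
def germ (M : (PSpace n).Modules) (U : (PSpace n).Opens) (x : PSpace n) (hx : x ∈ U)
    (s : Γ(M, U)) : Stalk M x :=
  TopCat.Presheaf.germ (C := Ab) M.presheaf U x hx s

theorem germ_smul (M : (PSpace n).Modules) (U : (PSpace n).Opens) (x : PSpace n) (hx : x ∈ U)
    (r : Γ(PSpace n, U)) (s : Γ(M, U)) :
    germ M U x hx (r • s) = (PSpace n).presheaf.germ U x hx r • germ M U x hx s :=
  PresheafOfModules.germ_smul (R := (PSpace n).presheaf) M.val x U hx r s

/-- The map of abelian groups induced on stalks by a morphism of `𝒪`-modules. -/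
def stalkAddHom {M N : (PSpace n).Modules} (φ : M ⟶ N) (x : PSpace n) :
    Stalk M x →+ Stalk N x :=
  ((TopCat.Presheaf.stalkFunctor Ab x).map φ.mapPresheaf).hom

theorem stalkAddHom_germ {M N : (PSpace n).Modules} (φ : M ⟶ N) (U : (PSpace n).Opens)
    (x : PSpace n) (hx : x ∈ U) (s : Γ(M, U)) :
    stalkAddHom φ x (germ M U x hx s) = germ N U x hx (φ.app U s) :=
  TopCat.Presheaf.stalkFunctor_map_germ_apply (C := Ab) U x hx φ.mapPresheaf s

theorem exists_germ_smul_germ {M : (PSpace n).Modules} {x : PSpace n}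
    (r : (PSpace n).presheaf.stalk x) (m : Stalk M x) :
    ∃ (U : (PSpace n).Opens) (hx : x ∈ U) (t : Γ(PSpace n, U)) (s : Γ(M, U)),
      r = (PSpace n).presheaf.germ U x hx t ∧ m = germ M U x hx s := by
  obtain ⟨U, hU, t, rfl⟩ := TopCat.Presheaf.exists_germ_eq (PSpace n).presheaf r
  obtain ⟨V, hVU, hV, s, hs⟩ := TopCat.Presheaf.exists_le_germ_eq (C := Ab) M.presheaf m hU
  exact ⟨V, hV, (PSpace n).presheaf.map (homOfLE hVU).op t, s,
    (TopCat.Presheaf.germ_res_apply (PSpace n).presheaf (homOfLE hVU) x hV t).symm, hs.symm⟩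

/-- The `𝒪_x`-linear map induced on stalks by a morphism of `𝒪`-modules. -/
def stalkMap {M N : (PSpace n).Modules} (φ : M ⟶ N) (x : PSpace n) :
    Stalk M x →ₗ[(PSpace n).presheaf.stalk x] Stalk N x where
  __ := stalkAddHom φ x
  map_smul' r m := by
    obtain ⟨U, hx, t, s, rfl, rfl⟩ := exists_germ_smul_germ r m
    change stalkAddHom φ x (_ • germ M U x hx s) = _ • stalkAddHom φ x (germ M U x hx s)
    rw [← germ_smul, stalkAddHom_germ, stalkAddHom_germ, Scheme.Modules.Hom.app_smul, germ_smul]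
    rfl

/-- The fibre `M_x / 𝔪_x M_x` of an `𝒪`-module at a point. -/
abbrev Fibre (M : (PSpace n).Modules) (x : PSpace n) : Type :=
  Stalk M x ⧸ (IsLocalRing.maximalIdeal ((PSpace n).presheaf.stalk x) •
    (⊤ : Submodule ((PSpace n).presheaf.stalk x) (Stalk M x)))

/-- The fibre is a complex vector space through the constant functions. -/
instance (M : (PSpace n).Modules) (x : PSpace n) : Module ℂ (Fibre M x) :=
  Module.compHom (Fibre M x) (constStalk x)

/-- The `ℂ`-linear map induced on fibres by a morphism of `𝒪`-modules. -/
def fibreMap {M N : (PSpace n).Modules} (φ : M ⟶ N) (x : PSpace n) :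
    Fibre M x →ₗ[ℂ] Fibre N x where
  toFun := Submodule.mapQ _ _ (stalkMap φ x) (by
    rw [← Submodule.map_le_iff_le_comap, Submodule.map_smul'']
    exact Submodule.smul_mono le_rfl le_top)
  map_add' := map_add _
  map_smul' c m := map_smul _ (constStalk x c) m

end Fibres

section DualTensor

variable {n : ℕ}

/-- The structure sheaf `𝒪` of `ℙⁿ` as a module over itself. -/
def structureModule (n : ℕ) : (PSpace n).Modules :=
  SheafOfModules.unit (PSpace n).ringCatSheaf

/-- `Hom(E|_U, F|_U)`: compatible families of `𝒪(V)`-linear maps `E(V) → F(V)`, for `V ⊆ U`. -/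
def localHom (E F : (PSpace n).Modules) (U : (PSpace n).Opens) :
    AddSubgroup (∀ V : {V : (PSpace n).Opens // V ≤ U}, Γ(E, V.1) →ₗ[Γ(PSpace n, V.1)] Γ(F, V.1)) where
  carrier := {φ | ∀ (V W : {V : (PSpace n).Opens // V ≤ U}) (h : W.1 ≤ V.1) (s : Γ(E, V.1)),
    φ W (E.presheaf.map (homOfLE h).op s) = F.presheaf.map (homOfLE h).op (φ V s)}
  add_mem' {φ ψ} hφ hψ V W h s := by
    simp only [Pi.add_apply, LinearMap.add_apply, hφ V W h s, hψ V W h s, map_add]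
  zero_mem' V W h s := by simp
  neg_mem' {φ} hφ V W h s := by
    simp only [Pi.neg_apply, LinearMap.neg_apply, hφ V W h s, map_neg]

@[ext]
theorem localHom_ext {E F : (PSpace n).Modules} {U : (PSpace n).Opens} {φ ψ : localHom E F U}
    (h : ∀ V s, φ.1 V s = ψ.1 V s) : φ = ψ :=
  Subtype.ext (funext fun V => LinearMap.ext (h V))

/-- `Hom(E|_U, F|_U)` is an `𝒪(U)`-module. -/
instance localHomModule (E F : (PSpace n).Modules) (U : (PSpace n).Opens) :
    Module Γ(PSpace n, U) (localHom E F U) where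
  smul r φ := ⟨fun V => (PSpace n).presheaf.map (homOfLE V.2).op r • φ.1 V, fun V W h s => by
    have h1 : (PSpace n).presheaf.map (homOfLE W.2).op r =
        (PSpace n).presheaf.map (homOfLE h).op ((PSpace n).presheaf.map (homOfLE V.2).op r) := by
      rw [← ConcreteCategory.comp_apply, ← Functor.map_comp]
      rfl
    rw [LinearMap.smul_apply, LinearMap.smul_apply, φ.2 V W h s, h1, Scheme.Modules.map_smul]⟩
  one_smul φ := by
    ext V s
    change (PSpace n).presheaf.map (homOfLE V.2).op 1 • φ.1 V s = _
    rw [map_one, one_smul]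
  mul_smul r r' φ := by
    ext V s
    change (PSpace n).presheaf.map (homOfLE V.2).op (r * r') • φ.1 V s =
      (PSpace n).presheaf.map (homOfLE V.2).op r • (PSpace n).presheaf.map (homOfLE V.2).op r' • φ.1 V s
    rw [map_mul, mul_smul]
  smul_zero r := by
    ext V s
    exact smul_zero ((PSpace n).presheaf.map (homOfLE V.2).op r)
  smul_add r φ ψ := by
    ext V s
    exact smul_add ((PSpace n).presheaf.map (homOfLE V.2).op r) (φ.1 V s) (ψ.1 V s)
  add_smul r r' φ := by
    ext V s
    change (PSpace n).presheaf.map (homOfLE V.2).op (r + r') • φ.1 V s =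
      (PSpace n).presheaf.map (homOfLE V.2).op r • φ.1 V s +
        (PSpace n).presheaf.map (homOfLE V.2).op r' • φ.1 V s
    rw [map_add, add_smul]
  zero_smul φ := by
    ext V s
    change (PSpace n).presheaf.map (homOfLE V.2).op 0 • φ.1 V s = 0
    rw [map_zero, zero_smul]

/-- The presheaf of abelian groups `U ↦ Hom(E|_U, F|_U)`. -/
def localHomPresheaf (E F : (PSpace n).Modules) : (Opens (PSpace n))ᵒᵖ ⥤ Ab.{0} where
  obj U := AddCommGrpCat.of (localHom E F U.unop)
  map {U V} i := AddCommGrpCat.ofHom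
    { toFun := fun φ => ⟨fun W => φ.1 ⟨W.1, W.2.trans i.unop.le⟩, fun W W' h s =>
        φ.2 ⟨W.1, W.2.trans i.unop.le⟩ ⟨W'.1, W'.2.trans i.unop.le⟩ h s⟩
      map_zero' := rfl
      map_add' := fun _ _ => rfl }

instance (E F : (PSpace n).Modules) (U : (Opens (PSpace n))ᵒᵖ) :
    Module ((PSpace n).ringCatSheaf.obj.obj U) ((localHomPresheaf E F).obj U) :=
  inferInstanceAs (Module Γ(PSpace n, U.unop) (localHom E F U.unop))

/-- The presheaf of `𝒪`-modules `U ↦ Hom(E|_U, F|_U)`. -/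
def homPresheafOfModules (E F : (PSpace n).Modules) : (PSpace n).PresheafOfModules :=
  PresheafOfModules.ofPresheaf (localHomPresheaf E F) (fun U V i r φ => by
    refine localHom_ext (fun W s => ?_)
    have h1 (t : Γ(PSpace n, U.unop)) : (PSpace n).presheaf.map (homOfLE (W.2.trans i.unop.le)).op t =
        (PSpace n).presheaf.map (homOfLE W.2).op ((PSpace n).presheaf.map i t) := by
      rw [← ConcreteCategory.comp_apply, ← Functor.map_comp]
      rfl
    exact congrArg (fun t => t • φ.1 ⟨W.1, W.2.trans i.unop.le⟩ s) (h1 r))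

/-- The sheaf of `𝒪`-modules associated with a presheaf of `𝒪`-modules. -/
def sheafify (P : (PSpace n).PresheafOfModules) : (PSpace n).Modules :=
  (PresheafOfModules.sheafification (𝟙 (PSpace n).ringCatSheaf.obj)).obj P

/-- The dual `E^* = ℋom(E, 𝒪)`. The presheaf `U ↦ Hom(E|_U, 𝒪_U)` is already a sheaf, so the
sheafification does not change it; it only serves to provide the sheaf condition. -/
def dual (E : (PSpace n).Modules) : (PSpace n).Modules :=
  sheafify (homPresheafOfModules E (structureModule n))

/-- The tensor product of two `𝒪`-modules: the sheaf associated with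
`U ↦ M(U) ⊗_{𝒪(U)} N(U)`. -/
def tensor (M N : (PSpace n).Modules) : (PSpace n).Modules :=
  sheafify (PresheafOfModules.Monoidal.tensorObj (R := (PSpace n).presheaf) M.val N.val)

/-- `M` is globally generated: some family of global sections defines an epimorphism
`𝒪^{⊕ I} ⟶ M`. -/
def IsGloballyGenerated (M : (PSpace n).Modules) : Prop :=
  Nonempty (SheafOfModules.GeneratingSections (R := (PSpace n).ringCatSheaf) M)

end DualTensor

section Bundles

variable {n : ℕ}

/-- `M` is a vector bundle of rank `r`: every point has an open neighbourhood `U`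
with `M|_U ≅ 𝒪_U^r`. -/
def IsVectorBundle (M : (PSpace n).Modules) (r : ℕ) : Prop :=
  ∀ x : PSpace n, ∃ U : (PSpace n).Opens, x ∈ U ∧
    Nonempty (M.restrict U.ι ≅
      (SheafOfModules.free (R := U.toScheme.ringCatSheaf) (Fin r) : U.toScheme.Modules))

/-- `Ext¹(F, E) = 0`. -/
def ExtOneVanishes (F E : (PSpace n).Modules) : Prop :=
  haveI : HasExt.{1} (PSpace n).Modules := HasExt.standard _
  Subsingleton (Abelian.Ext F E 1)

/-- The standing conditions on the pair of vector bundles `E`, `F`, of ranks `rE`, `rF`. -/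
structure IsAdmissiblePair (E F : (PSpace n).Modules) (rE rF : ℕ) : Prop where
  bundle_left : IsVectorBundle E rE
  bundle_right : IsVectorBundle F rF
  simple_left : Module.finrank ℂ (E ⟶ E) = 1
  simple_right : Module.finrank ℂ (F ⟶ F) = 1
  hom_eq_zero : ∀ φ : F ⟶ E, φ = 0
  ext_eq_zero : ExtOneVanishes F E
  globallyGenerated : IsGloballyGenerated (tensor (dual E) F)
  three_le : 3 ≤ Module.finrank ℂ (E ⟶ F)

instance : HasFiniteBiproducts (PSpace n).Modules := Abelian.hasFiniteBiproducts

/-- The direct sum `E^{⊕ a}`. -/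
abbrev power (E : (PSpace n).Modules) (a : ℕ) : (PSpace n).Modules :=
  ⨁ fun _ : Fin a => E

/-- `0 ⟶ E^a ⟶ F^b ⟶ C ⟶ 0` is exact for suitable maps. -/
def HasResolution (E F C : (PSpace n).Modules) (a b : ℕ) : Prop :=
  ∃ (α : power E a ⟶ power F b) (π : power F b ⟶ C) (h : α ≫ π = 0),
    (ShortComplex.mk α π h).ShortExact

/-- Vector bundles `C` with a resolution `0 ⟶ E^a ⟶ F^b ⟶ C ⟶ 0` for some `a`, `b`
(no condition on the rank). -/
def isResolvedBundle (E F : (PSpace n).Modules) : ObjectProperty (PSpace n).Modules :=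
  fun C => (∃ r, IsVectorBundle C r) ∧ ∃ a b, HasResolution E F C a b

/-- Cokernel bundles of type `(E, F)`: vector bundles `C` with a resolution
`0 ⟶ E^a ⟶ F^b ⟶ C ⟶ 0` where `b rk F - a rk E ≥ n`. -/
def isCokernelBundle (E F : (PSpace n).Modules) (rE rF : ℕ) :
    ObjectProperty (PSpace n).Modules :=
  fun C => (∃ r, IsVectorBundle C r) ∧
    ∃ a b, HasResolution E F C a b ∧ (n : ℤ) ≤ (b : ℤ) * rF - (a : ℤ) * rE

end Bundles

section Quiver

/-- A representation of the Kronecker quiver `K_w` (two vertices, `w` arrows from the first to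
the second) on finite-dimensional complex vector spaces. -/
structure KroneckerRep (w : ℕ) where
  /-- the space at the tail -/
  V : Type
  /-- the space at the head -/
  W : Type
  [addCommGroupV : AddCommGroup V]
  [moduleV : Module ℂ V]
  [finiteV : FiniteDimensional ℂ V]
  [addCommGroupW : AddCommGroup W]
  [moduleW : Module ℂ W]
  [finiteW : FiniteDimensional ℂ W]
  /-- the maps attached to the arrows -/
  map : Fin w → (V →ₗ[ℂ] W)

namespace KroneckerRep

attribute [instance] addCommGroupV moduleV finiteV addCommGroupW moduleW finiteW

variable {w : ℕ}

/-- Morphisms of representations. -/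
@[ext]
structure Hom (A B : KroneckerRep w) where
  /-- the map at the tail -/
  left : A.V →ₗ[ℂ] B.V
  /-- the map at the head -/
  right : A.W →ₗ[ℂ] B.W
  comm : ∀ i, right ∘ₗ A.map i = B.map i ∘ₗ left

instance : Category (KroneckerRep w) where
  Hom := Hom
  id A := ⟨LinearMap.id, LinearMap.id, fun _ => rfl⟩
  comp f g := ⟨g.left ∘ₗ f.left, g.right ∘ₗ f.right, fun i => by
    rw [LinearMap.comp_assoc, f.comm, ← LinearMap.comp_assoc, g.comm, LinearMap.comp_assoc]⟩

end KroneckerRep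

end Quiver

section Functor

variable {n : ℕ}

/-- `V ⊗ E` for a finite-dimensional vector space `V`, as the direct sum of `dim V` copies of `E`
(using a chosen basis of `V`). -/
abbrev vtensor (V : Type) [AddCommGroup V] [Module ℂ V] [FiniteDimensional ℂ V]
    (E : (PSpace n).Modules) : (PSpace n).Modules :=
  power E (Module.finrank ℂ V)

/-- `f ⊗ φ : V ⊗ E ⟶ W ⊗ F`, with matrix entries `f_{ij} φ`. -/
def vtensorMap {V W : Type} [AddCommGroup V] [Module ℂ V] [FiniteDimensional ℂ V]
    [AddCommGroup W] [Module ℂ W] [FiniteDimensional ℂ W] {E F : (PSpace n).Modules}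
    (f : V →ₗ[ℂ] W) (φ : E ⟶ F) : vtensor V E ⟶ vtensor W F :=
  biproduct.matrix fun j i =>
    LinearMap.toMatrix (Module.finBasis ℂ V) (Module.finBasis ℂ W) f i j • φ

section

variable {U V W : Type} [AddCommGroup U] [Module ℂ U] [FiniteDimensional ℂ U]
  [AddCommGroup V] [Module ℂ V] [FiniteDimensional ℂ V]
  [AddCommGroup W] [Module ℂ W] [FiniteDimensional ℂ W] {E F G : (PSpace n).Modules}

theorem vtensorMap_id : vtensorMap (LinearMap.id : V →ₗ[ℂ] V) (𝟙 E) = 𝟙 (vtensor V E) := by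
  refine biproduct.hom_ext' _ _ fun j => biproduct.hom_ext _ _ fun i => ?_
  rw [vtensorMap, biproduct.ι_matrix, biproduct.lift_π, LinearMap.toMatrix_id,
    Category.comp_id, biproduct.ι_π, Matrix.one_apply]
  by_cases h : i = j
  · subst h
    simp
  · rw [if_neg h, dif_neg (Ne.symm h), zero_smul]

theorem vtensorMap_comp (f : U →ₗ[ℂ] V) (g : V →ₗ[ℂ] W) (φ : E ⟶ F) (ψ : F ⟶ G) :
    vtensorMap f φ ≫ vtensorMap g ψ = vtensorMap (g ∘ₗ f) (φ ≫ ψ) := by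
  refine biproduct.hom_ext' _ _ fun j => biproduct.hom_ext _ _ fun i => ?_
  simp only [vtensorMap, Category.assoc, biproduct.matrix_π, biproduct.ι_matrix_assoc,
    biproduct.ι_desc, biproduct.lift_desc]
  rw [LinearMap.toMatrix_comp (Module.finBasis ℂ U) (Module.finBasis ℂ V) (Module.finBasis ℂ W),
    Matrix.mul_apply, Finset.sum_smul]
  refine Finset.sum_congr rfl fun k _ => ?_
  rw [Linear.smul_comp, Linear.comp_smul, smul_smul, mul_comm]

end

variable {E F : (PSpace n).Modules} {w : ℕ}

/-- The morphism `α = ∑ i, A_i ⊗ σ_i : V ⊗ E ⟶ W ⊗ F` attached to a representation. -/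
def alpha (σ : Module.Basis (Fin w) ℂ (E ⟶ F)) (A : KroneckerRep w) :
    vtensor A.V E ⟶ vtensor A.W F :=
  ∑ i, vtensorMap (A.map i) (σ i)

theorem alpha_comm (σ : Module.Basis (Fin w) ℂ (E ⟶ F)) {A B : KroneckerRep w} (f : A ⟶ B) :
    alpha σ A ≫ vtensorMap f.right (𝟙 F) = vtensorMap f.left (𝟙 E) ≫ alpha σ B := by
  rw [alpha, alpha, Preadditive.sum_comp, Preadditive.comp_sum]
  refine Finset.sum_congr rfl fun i _ => ?_
  rw [vtensorMap_comp, vtensorMap_comp, f.comm, Category.comp_id, Category.id_comp]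

/-- The functor `A ↦ coker (∑ i, A_i ⊗ σ_i)`; a morphism `(f₁, f₂)` goes to the morphism
of cokernels induced by `f₁ ⊗ 1_E` and `f₂ ⊗ 1_F`. -/
def cokernelFunctor (σ : Module.Basis (Fin w) ℂ (E ⟶ F)) :
    KroneckerRep w ⥤ (PSpace n).Modules where
  obj A := cokernel (alpha σ A)
  map {A B} f := cokernel.map (alpha σ A) (alpha σ B)
    (vtensorMap f.left (𝟙 E)) (vtensorMap f.right (𝟙 F)) (alpha_comm σ f)
  map_id A := by
    rw [← cancel_epi (cokernel.π _), cokernel.π_desc, Category.comp_id]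
    change vtensorMap LinearMap.id (𝟙 F) ≫ _ = _
    rw [vtensorMap_id, Category.id_comp]
  map_comp {A B C} f g := by
    rw [← cancel_epi (cokernel.π _), cokernel.π_desc, cokernel.π_desc_assoc, Category.assoc,
      cokernel.π_desc, ← Category.assoc, vtensorMap_comp, Category.comp_id]
    rfl

/-- `A` is `(E, F, σ)`-globally injective: for each (closed) point `P` of `ℙⁿ` the map
`∑ i, A_i ⊗ σ_i(P) : V ⊗ E_P → W ⊗ F_P` is injective. -/
def isGloballyInjective (σ : Module.Basis (Fin w) ℂ (E ⟶ F)) :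
    ObjectProperty (KroneckerRep w) :=
  fun A => ∀ P : PSpace n, IsClosed {P} →
    Function.Injective (∑ i, TensorProduct.map (A.map i) (fibreMap (σ i) P) :
      A.V ⊗[ℂ] Fibre E P →ₗ[ℂ] A.W ⊗[ℂ] Fibre F P)

/-- Globally injective representations with `dim W * rk F - dim V * rk E ≥ n`. -/
def isGloballyInjectiveOfRank (rE rF : ℕ) (σ : Module.Basis (Fin w) ℂ (E ⟶ F)) :
    ObjectProperty (KroneckerRep w) :=
  fun A => isGloballyInjective σ A ∧
    (n : ℤ) ≤ (Module.finrank ℂ A.W : ℤ) * rF - (Module.finrank ℂ A.V : ℤ) * rE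

end Functor

end CokernelBundles

end

/-! Two arguments combine, one homological and one local.

Homological: since `σ` is a basis, every morphism `E^a ⟶ F^b` is `∑ A_i ⊗ σ_i` for exactly one tuple
of matrices (`exists_sum_vtensorMap_eq`, `sum_vtensorMap_injective`), and since `E` and `F` are
simple, morphisms between powers of `E`, or of `F`, are scalar matrices (`vtensorMap_id_bijective`).
Let `alpha σ B` be a monomorphism. A morphism `coker (alpha σ A) ⟶ coker (alpha σ B)` lifts to `W_A
⊗ F ⟶ W_B ⊗ F` because `Ext¹(F, E) = 0`. The lift is unique, because two lifts differ by a morphism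
into `V_B ⊗ E`, and `Hom(F, E) = 0`. It has the form `g ⊗ 1`, it induces some `f ⊗ 1` from `V_A ⊗ E`
to `V_B ⊗ E`, and comparing coefficients of the `σ_i` shows that `(f, g)` is a morphism of
representations. This is `cokernelFunctor_map_bijective`.

Local: `α : E^a ⟶ F^b` is injective on the fibres at closed points exactly when it is a monomorphism
with locally free cokernel. If it is injective on a fibre, a determinant form of Nakayama's lemma
shows that `α` carries a local frame to part of a local frame, and the remaining sections form a
frame of the cokernel; closed points suffice, as every point specializes to one
(`mono_of_fibreMap_injective`, `isVectorBundle_cokernel`). Conversely, local lifts of a frame of the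
cokernel complete the image of a frame of `E^a` to a frame of `F^b`, so `α` splits on stalks
(`fibreMap_injective_of_shortExact`). The first direction puts the values of the functor among the
required bundles, the second gives essential surjectivity. The exponents of the resolutions are `dim
V` and `dim W`, so the rank conditions in (b) agree. -/

noncomputable section

/-! ### Frames of sheaves of modules -/

namespace CokernelBundles

variable {X : Scheme.{0}}

/-- Restriction of a section of an `𝒪`-module to a smaller open subset. -/
def res (M : X.Modules) {U V : X.Opens} (h : V ≤ U) : Γ(M, U) →+ Γ(M, V) :=
  (M.presheaf.map (homOfLE h).op).hom

theorem res_res (M : X.Modules) {U V W : X.Opens} (h : V ≤ U) (h' : W ≤ V) (s : Γ(M, U)) :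
    res M h' (res M h s) = res M (h'.trans h) s := by
  change (M.presheaf.map (homOfLE h).op ≫ M.presheaf.map (homOfLE h').op) s = _
  rw [← Functor.map_comp]; rfl

theorem res_self (M : X.Modules) {U : X.Opens} (s : Γ(M, U)) : res M le_rfl s = s := by
  change M.presheaf.map (𝟙 _) s = s
  rw [CategoryTheory.Functor.map_id]; rfl

theorem res_smul (M : X.Modules) {U V : X.Opens} (h : V ≤ U) (r : Γ(X, U)) (s : Γ(M, U)) :
    res M h (r • s) = X.presheaf.map (homOfLE h).op r • res M h s :=
  Scheme.Modules.map_smul M (homOfLE h) r s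

theorem app_res {M N : X.Modules} (φ : M ⟶ N) {U V : X.Opens} (h : V ≤ U) (s : Γ(M, U)) :
    φ.app V (res M h s) = res N h (φ.app U s) :=
  congr($(φ.mapPresheaf.naturality (homOfLE h).op) s)

/-- The sections `e i` of `M` over `U` form a basis over each open subset of `U`. -/
def IsFrame (M : X.Modules) (U : X.Opens) {ι : Type} [Fintype ι] (e : ι → Γ(M, U)) : Prop :=
  ∀ (V : X.Opens) (h : V ≤ U),
    Function.Bijective fun c : ι → Γ(X, V) => ∑ i, c i • res M h (e i)

namespace IsFrame
variable {M N : X.Modules} {U V : X.Opens} {ι κ : Type} [Fintype ι] [Fintype κ]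

theorem res {e : ι → Γ(M, U)} (he : IsFrame M U e) (h : V ≤ U) :
    IsFrame M V fun i => res M h (e i) := fun W hW => by
  simpa only [res_res] using he W (hW.trans h)

theorem reindex {e : ι → Γ(M, U)} (he : IsFrame M U e) (f : κ ≃ ι) :
    IsFrame M U (e ∘ f) := fun W hW => by
  have := (he W hW).comp ((Equiv.arrowCongr f (Equiv.refl Γ(X, W))).bijective)
  convert this using 1
  funext c
  exact Fintype.sum_equiv f _ _ (fun i => by simp)

theorem map_iso {e : ι → Γ(M, U)} (he : IsFrame M U e) (φ : M ≅ N) :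
    IsFrame N U fun i => φ.hom.app U (e i) := fun W hW => by
  have h1 : Function.Bijective (φ.hom.app W) := ConcreteCategory.bijective_of_isIso _
  convert h1.comp (he W hW) using 1
  funext c
  simp only [Function.comp, map_sum, Scheme.Modules.Hom.app_smul, app_res]

end IsFrame

theorem comp_app_apply {M N K : X.Modules} (φ : M ⟶ N) (ψ : N ⟶ K) (U : X.Opens) (s : Γ(M, U)) :
    (φ ≫ ψ).app U s = ψ.app U (φ.app U s) := rfl

theorem sum_app_apply {M N : X.Modules} {κ : Type} (t : Finset κ) (φ : κ → (M ⟶ N))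
    (U : X.Opens) (s : Γ(M, U)) :
    (∑ k ∈ t, φ k).app U s = ∑ k ∈ t, (φ k).app U s := by
  classical
  induction t using Finset.induction_on with
  | empty => simp
  | insert a t ha ih => rw [Finset.sum_insert ha, Finset.sum_insert ha, ← ih]; rfl

/-- The projections read off the coordinates block by block. Inclusions and projections are
abstract, so that this covers both `freeModule` and `power`. -/
theorem IsFrame.biproduct {κ ι : Type} [Fintype κ] [Fintype ι] [DecidableEq κ]
    {M N : X.Modules} (i : κ → (N ⟶ M)) (p : κ → (M ⟶ N))
    (h : ∀ j k, i j ≫ p k = if j = k then 𝟙 N else 0) (h' : ∑ k, p k ≫ i k = 𝟙 M) {U : X.Opens}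
    {e : ι → Γ(N, U)} (he : IsFrame N U e) :
    IsFrame M U fun x : κ × ι => (i x.1).app U (e x.2) := by
  intro W hW
  have key (c : κ × ι → Γ(X, W)) (k : κ) :
      (p k).app W (∑ x, c x • CokernelBundles.res M hW ((i x.1).app U (e x.2))) =
      ∑ y, c (k, y) • CokernelBundles.res N hW (e y) := by
    rw [Fintype.sum_prod_type, map_sum, Finset.sum_eq_single k]
    · rw [map_sum]
      refine Finset.sum_congr rfl fun y _ => ?_
      rw [Scheme.Modules.Hom.app_smul, ← app_res, ← comp_app_apply, h, if_pos rfl]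
      rfl
    · intro j _ hj
      rw [map_sum]
      refine Finset.sum_eq_zero fun y _ => ?_
      rw [Scheme.Modules.Hom.app_smul, ← app_res, ← comp_app_apply, h, if_neg hj]
      exact smul_zero (A := Γ(N, W)) _
    · simp
  constructor
  · intro c d hcd
    funext ⟨k, y⟩
    have := congrArg ((p k).app W) hcd
    simp only [key] at this
    exact congrFun ((he W hW).1 this) y
  · intro s
    choose c hc using fun k => (he W hW).2 ((p k).app W s)
    refine ⟨fun x => c x.1 x.2, ?_⟩
    have hs : s = ∑ k, (i k).app W ((p k).app W s) := by
      conv_lhs => rw [show s = (𝟙 M : M ⟶ M).app W s from rfl, ← h', sum_app_apply]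
      rfl
    conv_rhs => rw [hs]
    refine (Fintype.sum_prod_type _).trans ?_
    refine Finset.sum_congr rfl fun k _ => ?_
    rw [← hc]
    refine Eq.trans ?_ (map_sum ((i k).app W).hom _ _).symm
    refine Finset.sum_congr rfl fun y _ => ?_
    rw [Scheme.Modules.Hom.app_smul, ← app_res]

end CokernelBundles

/-! ### Free modules and restrictions to open subsets, in terms of frames -/

namespace CokernelBundles

variable {X : Scheme.{0}}

/-- The structure sheaf as a module over itself. -/
abbrev unitModule (X : Scheme.{0}) : X.Modules := SheafOfModules.unit X.ringCatSheaf

/-- The free module of rank `ι`. -/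
abbrev freeModule (X : Scheme.{0}) (ι : Type) : X.Modules :=
  SheafOfModules.free (R := X.ringCatSheaf) ι

/-- A section of the structure sheaf as a section of `unitModule`. -/
def toUnit {U : X.Opens} (r : Γ(X, U)) : Γ(unitModule X, U) := r

theorem smul_res_toUnit_one {U V : X.Opens} (h : V ≤ U) (r : Γ(X, V)) :
    r • res (unitModule X) h (toUnit 1) = toUnit r := by
  have : res (unitModule X) h (toUnit 1) = toUnit (1 : Γ(X, V)) :=
    map_one (X.presheaf.map (homOfLE h).op).hom
  rw [this]
  exact mul_one (M := Γ(X, V)) r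

theorem IsFrame.unit (U : X.Opens) :
    IsFrame (unitModule X) U (fun _ : Unit => toUnit 1) := by
  intro V h
  have key : ∀ c : Unit → Γ(X, V),
      (∑ i, c i • CokernelBundles.res (unitModule X) h (toUnit 1)) = toUnit (c ()) := fun c => by
    rw [Fintype.sum_unique, smul_res_toUnit_one]
  refine ⟨fun c d hcd => ?_, fun s => ⟨fun _ => s, (key _)⟩⟩
  funext _
  exact (key c).symm.trans (hcd.trans (key d))

/-- The inclusion of a summand of the free module. -/
abbrev ιFreeModule {ι : Type} (i : ι) : unitModule X ⟶ freeModule X ι :=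
  SheafOfModules.ιFree (R := X.ringCatSheaf) i

theorem freeModule_hom_ext {ι : Type} {M : X.Modules} {f g : freeModule X ι ⟶ M}
    (h : ∀ i, ιFreeModule i ≫ f = ιFreeModule i ≫ g) : f = g :=
  Cofan.IsColimit.hom_ext (SheafOfModules.isColimitFreeCofan (R := X.ringCatSheaf) ι) _ _ h

/-- The morphism from a free module given by its components. -/
def freeDesc {ι : Type} {M : X.Modules} (f : ι → (unitModule X ⟶ M)) : freeModule X ι ⟶ M :=
  Cofan.IsColimit.desc (SheafOfModules.isColimitFreeCofan (R := X.ringCatSheaf) ι) f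

theorem ιFreeModule_desc {ι : Type} {M : X.Modules} (f : ι → (unitModule X ⟶ M)) (i : ι) :
    ιFreeModule i ≫ freeDesc f = f i :=
  Cofan.IsColimit.fac (SheafOfModules.isColimitFreeCofan (R := X.ringCatSheaf) ι) f i

/-- The tautological frame of a free module. -/
def freeFrame (U : X.Opens) {ι : Type} (i : ι) : Γ(freeModule X ι, U) :=
  (ιFreeModule i).app U (toUnit 1)

theorem isFrame_freeFrame (U : X.Opens) (ι : Type) [Fintype ι] :
    IsFrame (freeModule X ι) U (freeFrame U) := by
  classical
  -- The free module is given as a coproduct; its projections come from the universal property.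
  have := (IsFrame.unit U).biproduct (M := freeModule X ι) ιFreeModule
    (fun k => freeDesc fun j => if j = k then 𝟙 (unitModule X) else 0)
    (fun j k => by rw [ιFreeModule_desc]) (freeModule_hom_ext fun j => by
      rw [Preadditive.comp_sum, Finset.sum_eq_single j]
      · rw [← Category.assoc, ιFreeModule_desc, if_pos rfl, Category.id_comp, Category.comp_id]
      · intro k _ hk
        rw [← Category.assoc, ιFreeModule_desc, if_neg (Ne.symm hk), zero_comp]
      · simp)
  exact this.reindex (Equiv.prodPUnit ι).symm

/-- The morphism `𝒪 ⟶ M` given by a global section. -/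
def ofSection {M : X.Modules} (s : Γ(M, ⊤)) : unitModule X ⟶ M :=
  (SheafOfModules.unitHomEquiv (R := X.ringCatSheaf) M).symm
    (PresheafOfModules.sectionsMk (M := M.val) (fun V => res M (U := ⊤) (V := V.unop) le_top s)
      fun _ _ f => res_res M le_top f.unop.le s)

theorem ofSection_app_one {M : X.Modules} (s : Γ(M, ⊤)) (U : X.Opens) :
    (ofSection s).app U (toUnit 1) = res M le_top s := by
  have := congrArg (fun t : M.val.sections => t.val (op U))
    ((SheafOfModules.unitHomEquiv (R := X.ringCatSheaf) M).apply_symm_apply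
    (PresheafOfModules.sectionsMk (M := M.val) (fun V => res M (U := ⊤) (V := V.unop) le_top s)
      fun _ _ f => res_res M le_top f.unop.le s))
  exact this

/-- The morphism from a free module given by sections. -/
def freeOfSections {ι : Type} {M : X.Modules} (e : ι → Γ(M, ⊤)) : freeModule X ι ⟶ M :=
  freeDesc fun i => ofSection (e i)

theorem freeOfSections_app_freeFrame {ι : Type} {M : X.Modules} (e : ι → Γ(M, ⊤)) (U : X.Opens)
    (i : ι) : (freeOfSections e).app U (freeFrame U i) = res M le_top (e i) := by
  rw [freeFrame, ← comp_app_apply, freeOfSections, ιFreeModule_desc, ofSection_app_one]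

theorem res_freeFrame {ι : Type} {U V : X.Opens} (h : V ≤ U) (i : ι) :
    res (freeModule X ι) h (freeFrame U i) = freeFrame V i := by
  rw [freeFrame, ← app_res, freeFrame]
  congr 1
  exact map_one (X.presheaf.map (homOfLE h).op).hom

theorem isIso_of_bijective {M N : X.Modules} (φ : M ⟶ N)
    (h : ∀ U, Function.Bijective (φ.app U)) : IsIso φ :=
  Scheme.Modules.Hom.isIso_iff_isIso_app.2 fun U =>
    (ConcreteCategory.isIso_iff_bijective (φ.app U)).2 (h U)

theorem IsFrame.isIso_freeOfSections {ι : Type} [Fintype ι] {M : X.Modules} {e : ι → Γ(M, ⊤)}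
    (he : IsFrame M ⊤ e) : IsIso (freeOfSections e) := by
  refine isIso_of_bijective _ fun U => ?_
  have h1 := isFrame_freeFrame U ι U le_rfl
  refine (Function.Bijective.of_comp_iff _ h1).1 ?_
  convert he U le_top using 1
  funext c
  simp only [Function.comp, map_sum, Scheme.Modules.Hom.app_smul, res_freeFrame,
    freeOfSections_app_freeFrame]

/-- Both sides have the same sections; only the rings of scalars differ, by the isomorphism
`appIso`. -/
theorem restrict_bijective_iff {ι : Type} [Fintype ι] {M : X.Modules} {U : X.Opens}
    (W : U.toScheme.Opens) (e : ι → Γ(M.restrict U.ι, W)) :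
    (Function.Bijective fun c : ι → Γ(U.toScheme, W) => ∑ i, c i • e i) ↔
    (Function.Bijective fun c : ι → Γ(X, U.ι ''ᵁ W) =>
      ∑ i, c i • (show Γ(M, U.ι ''ᵁ W) from e i)) := by
  have h : Function.Bijective fun (c : ι → Γ(U.toScheme, W)) i => (U.ι.appIso W).inv (c i) :=
    (Equiv.arrowCongr (Equiv.refl ι)
      (U.ι.appIso W).symm.commRingCatIsoToRingEquiv.toEquiv).bijective
  rw [← Function.Bijective.of_comp_iff _ h]
  rfl

theorem IsFrame.restrict {ι : Type} [Fintype ι] {M : X.Modules} {U : X.Opens} {e : ι → Γ(M, U)}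
    (he : IsFrame M U e) :
    IsFrame (M.restrict U.ι) ⊤
      (fun i => CokernelBundles.res M (V := U.ι ''ᵁ ⊤) (by simp) (e i)) := by
  intro W hW
  refine (restrict_bijective_iff W _).2 ?_
  have h1 : U.ι ''ᵁ W ≤ U := by simpa using U.ι.image_mono hW
  refine (congrArg Function.Bijective (funext fun c => ?_)).mp (he (U.ι ''ᵁ W) h1)
  refine Finset.sum_congr rfl fun i _ => congrArg (c i • ·) ?_
  exact (res_res M _ (U.ι.image_mono hW) (e i)).symm

theorem le_image_top (U : X.Opens) : U ≤ U.ι ''ᵁ ⊤ := by simp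

theorem IsFrame.of_restrict {ι : Type} [Fintype ι] {M : X.Modules} {U : X.Opens}
    {e : ι → Γ(M.restrict U.ι, ⊤)} (he : IsFrame (M.restrict U.ι) ⊤ e) :
    IsFrame M U (fun i => CokernelBundles.res M (U := U.ι ''ᵁ ⊤) (le_image_top U) (e i)) := by
  intro W hW
  have h0 : ∃ W', W = U.ι ''ᵁ W' := ⟨U.ι ⁻¹ᵁ W, by
    rw [Scheme.Hom.image_preimage_eq_opensRange_inf]; simpa⟩
  obtain ⟨W, rfl⟩ := h0
  have h1 := (restrict_bijective_iff W _).1 (he W le_top)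
  have h2 (i) : CokernelBundles.res M hW
      (CokernelBundles.res M (U := U.ι ''ᵁ ⊤) (le_image_top U) (e i))
      = CokernelBundles.res (M.restrict U.ι) (le_top : W ≤ ⊤) (e i) :=
    (res_res M (le_image_top U) hW (e i))
  simp only [h2]
  exact h1

theorem exists_isFrame {ι : Type} [Fintype ι] {M : X.Modules} {U : X.Opens}
    (φ : M.restrict U.ι ≅ freeModule U.toScheme ι) : ∃ e : ι → Γ(M, U), IsFrame M U e :=
  ⟨_, ((isFrame_freeFrame ⊤ ι).map_iso φ.symm).of_restrict⟩

end CokernelBundles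

/-! ### Linear algebra over a local ring; spreading out germs -/

namespace CokernelBundles

section LinearAlgebra

open IsLocalRing

variable {R M N : Type*} [CommRing R] [IsLocalRing R] [AddCommGroup M] [Module R M]
  [AddCommGroup N] [Module R N]

theorem mem_maximalIdeal_smul_top_iff {ι : Type*} [Fintype ι] (b : Module.Basis ι R M) (x : M) :
    x ∈ maximalIdeal R • (⊤ : Submodule R M) ↔ ∀ i, b.repr x i ∈ maximalIdeal R := by
  constructor
  · intro hx i
    refine Submodule.smul_induction_on hx (fun r hr y _ => ?_) fun y z hy hz => ?_
    · rw [map_smul]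
      exact Ideal.mul_mem_right _ _ hr
    · rw [map_add]
      exact Ideal.add_mem _ hy hz
  · intro h
    rw [← b.sum_repr x]
    exact Submodule.sum_mem _ fun i _ => Submodule.smul_mem_smul (h i) trivial

/-- A linear map between free modules over a local ring which is injective modulo the maximal
ideal maps a basis of the source to a part of a basis of the target. -/
theorem exists_basis_extending {ι κ : Type} [Fintype ι] [Fintype κ]
    (e : Module.Basis ι R M) (f : Module.Basis κ R N)
    (T : M →ₗ[R] N) (hT : ∀ y, T y ∈ maximalIdeal R • (⊤ : Submodule R N) →
      y ∈ maximalIdeal R • (⊤ : Submodule R M)) :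
    ∃ (s : ℕ) (b : Module.Basis (ι ⊕ Fin s) R N), ∀ i, b (Sum.inl i) = T (e i) := by
  classical
  -- `ρ` reduces coordinates modulo the maximal ideal; by `hT` the vectors `ρ (T (e i))` are
  -- independent, so they extend to a basis of the residue space, which is then lifted to `N`.
  let ρ (y : N) : κ → ResidueField R := fun k => residue R (f.repr y k)
  have hρ (c : ι → R) : ρ (T (∑ i, c i • e i)) = ∑ i, residue R (c i) • ρ (T (e i)) := by
    funext k
    simp [ρ, Finset.sum_apply]
  have hli : LinearIndependent (ResidueField R) fun i => ρ (T (e i)) := by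
    rw [Fintype.linearIndependent_iff]
    intro c hc i
    choose r hr using fun i => residue_surjective (R := R) (c i)
    simp only [← hr, ← hρ] at hc ⊢
    have h1 : T (∑ i, r i • e i) ∈ maximalIdeal R • (⊤ : Submodule R N) :=
      (mem_maximalIdeal_smul_top_iff f _).2 fun k => (residue_eq_zero_iff _).1 (congrFun hc k)
    have h2 := (mem_maximalIdeal_smul_top_iff e _).1 (hT _ h1) i
    rw [e.repr_sum_self] at h2
    exact (residue_eq_zero_iff _).2 h2
  let B := Module.Basis.sumExtend hli
  have hB (i) : B (Sum.inl i) = ρ (T (e i)) := by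
    simp only [B, Module.Basis.sumExtend, Module.Basis.reindex_apply,
      Module.Basis.extend_apply_self]
    rfl
  have : Finite (ι ⊕ Module.Basis.sumExtendIndex hli) := Module.Finite.finite_basis B
  have : Finite (Module.Basis.sumExtendIndex hli) := Finite.sum_right ι
  let s := Nat.card (Module.Basis.sumExtendIndex hli)
  let B' := B.reindex (Equiv.sumCongr (Equiv.refl ι)
    (Finite.equivFin (Module.Basis.sumExtendIndex hli)))
  have hB' (i) : B' (Sum.inl i) = ρ (T (e i)) := by
    rw [Module.Basis.reindex_apply]
    exact hB i
  have hlift : ∀ v : κ → ResidueField R, ∃ y, ρ y = v := fun v => by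
    choose r hr using fun k => residue_surjective (R := R) (v k)
    exact ⟨∑ k, r k • f k, funext fun k => by simp only [ρ, f.repr_sum_self, hr]⟩
  choose g hg using fun j => hlift (B' (Sum.inr j))
  let b' : ι ⊕ Fin s → N := Sum.elim (fun i => T (e i)) g
  have hb' (j) : ρ (b' j) = B' j := by
    cases j with
    | inl i => exact (hB' i).symm
    | inr j => exact hg j
  let σ : κ ≃ ι ⊕ Fin s := (Pi.basisFun (ResidueField R) κ).indexEquiv B'
  -- Over a local ring a determinant is a unit once its residue is one; the residue here is the
  -- determinant of the basis `B'`.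
  have hdet : IsUnit ((f.reindex σ).det b') := by
    rw [← isUnit_map_iff (residue R), Module.Basis.det_apply, RingHom.map_det]
    have := ((Pi.basisFun (ResidueField R) κ).reindex σ).isUnit_det B'
    rw [Module.Basis.det_apply] at this
    convert this using 2
    ext i j
    simp [Module.Basis.toMatrix_apply, ← hb', ρ]
  obtain ⟨h1, h2⟩ := ((f.reindex σ).is_basis_iff_det).2 hdet
  exact ⟨s, Module.Basis.mk h1 h2.ge, fun i => by simp [b']⟩

/-- `T` has a retraction, zero on the additional basis vectors, and linear maps preserve multiples
of the maximal ideal. -/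
theorem mem_smul_top_of_basis_extending {ι κ : Type*} (e : Module.Basis ι R M)
    (b : Module.Basis (ι ⊕ κ) R N) (T : M →ₗ[R] N) (h : ∀ i, T (e i) = b (Sum.inl i))
    {y : M} (hy : T y ∈ maximalIdeal R • (⊤ : Submodule R N)) :
    y ∈ maximalIdeal R • (⊤ : Submodule R M) := by
  let S : N →ₗ[R] M := b.constr R (Sum.elim e 0)
  have hS : S ∘ₗ T = LinearMap.id := e.ext fun i => by simp [S, h]
  rw [← LinearMap.id_apply (R := R) y, ← hS]
  have : (maximalIdeal R • (⊤ : Submodule R N)).map S ≤ maximalIdeal R • ⊤ := by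
    rw [Submodule.map_smul'']
    exact Submodule.smul_mono le_rfl le_top
  exact this ⟨_, hy, rfl⟩

end LinearAlgebra

theorem exists_le_of_finite {Y : TopCat.{0}} {x : Y} {U : Opens Y} (hx : x ∈ U) {ι : Type}
    [Finite ι] (W : ι → Opens Y) (hW : ∀ i, x ∈ W i) :
    ∃ V ≤ U, x ∈ V ∧ ∀ i, V ≤ W i := by
  have := Fintype.ofFinite ι
  refine ⟨U ⊓ Finset.univ.inf W, inf_le_left, ⟨hx, ?_⟩,
    fun i => inf_le_right.trans (Finset.inf_le (Finset.mem_univ i))⟩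
  rw [Opens.coe_finset_inf]
  simpa using hW

/-- The general target category allows use both for the structure sheaf and for the abelian sheaf
underlying a module. -/
theorem exists_lift_germs {C : Type 1} [Category.{0} C] [HasColimits C] {FC : C → C → Type}
    {CC : C → Type} [∀ X Y, FunLike (FC X Y) (CC X) (CC Y)] [ConcreteCategory.{0} C FC]
    [PreservesFilteredColimits (forget C)] {Y : TopCat.{0}} (F : Y.Presheaf C)
    {x : Y} {U : Opens Y} (hx : x ∈ U) {ι : Type} [Finite ι] (r : ι → ToType (F.stalk x)) :
    ∃ (V : Opens Y) (_ : V ≤ U) (hV : x ∈ V) (t : ι → ToType (F.obj (op V))),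
      ∀ i, F.germ V x hV (t i) = r i := by
  choose W hWU hxW t ht using fun i => F.exists_le_germ_eq (r i) hx
  obtain ⟨V, hVU, hV, hle⟩ := exists_le_of_finite hx W hxW
  exact ⟨V, hVU, hV, fun i => F.map (homOfLE (hle i)).op (t i), fun i => by
    rw [F.germ_res_apply, ht]⟩

end CokernelBundles

/-! ### Frames and bases of stalks -/

namespace CokernelBundles

variable {n : ℕ} {M N : (PSpace n).Modules} {U V : (PSpace n).Opens} {x : PSpace n}
  {ι κ : Type} [Fintype ι] [Fintype κ]

theorem germ_res (h : V ≤ U) (hx : x ∈ V) (s : Γ(M, U)) :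
    germ M V x hx (res M h s) = germ M U x (h hx) s :=
  TopCat.Presheaf.germ_res_apply M.presheaf (homOfLE h) x hx s

theorem germ_add (hx : x ∈ U) (s t : Γ(M, U)) :
    germ M U x hx (s + t) = germ M U x hx s + germ M U x hx t :=
  map_add (TopCat.Presheaf.germ M.presheaf U x hx).hom s t

theorem germ_zero (hx : x ∈ U) : germ M U x hx 0 = 0 :=
  map_zero (TopCat.Presheaf.germ M.presheaf U x hx).hom

theorem germ_sum_smul (hx : x ∈ U) (c : ι → Γ(PSpace n, U)) (e : ι → Γ(M, U)) :
    germ M U x hx (∑ i, c i • e i) =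
      ∑ i, (PSpace n).presheaf.germ U x hx (c i) • germ M U x hx (e i) := by
  simp only [← germ_smul]
  exact map_sum (TopCat.Presheaf.germ M.presheaf U x hx).hom _ _

theorem exists_res_eq_of_germ_eq (hx : x ∈ U) {s t : Γ(M, U)}
    (h : germ M U x hx s = germ M U x hx t) :
    ∃ (W : (PSpace n).Opens) (hW : W ≤ U), x ∈ W ∧ res M hW s = res M hW t := by
  obtain ⟨W, hxW, i, j, hij⟩ := TopCat.Presheaf.germ_eq M.presheaf x hx hx s t h
  exact ⟨W, i.le, hxW, hij⟩

theorem isUnit_map_of_le_basicOpen {X : Scheme.{0}} {U W : X.Opens} (f : Γ(X, U))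
    (hW : W ≤ X.basicOpen f) (hWU : W ≤ U) : IsUnit (X.presheaf.map (homOfLE hWU).op f) := by
  have h : X.presheaf.map (homOfLE hWU).op f =
      (X.presheaf.map (homOfLE hW).op) (X.presheaf.map (homOfLE (X.basicOpen_le f)).op f) := by
    rw [← ConcreteCategory.comp_apply, ← Functor.map_comp]
    rfl
  rw [h]
  exact (RingedSpace.isUnit_res_basicOpen X.toRingedSpace f).map
    (X.presheaf.map (homOfLE hW).op).hom

namespace IsFrame

/-- A relation between germs already holds over a neighbourhood, where the frame is independent. -/
theorem linearIndependent_germ {e : ι → Γ(M, U)} (he : IsFrame M U e) (hx : x ∈ U) :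
    LinearIndependent ((PSpace n).presheaf.stalk x) fun i => germ M U x hx (e i) := by
  rw [Fintype.linearIndependent_iff]
  intro r hr
  obtain ⟨V, hV, hxV, t, ht⟩ := exists_lift_germs (PSpace n).presheaf hx r
  simp only [← ht, ← germ_res hV hxV] at hr
  rw [← germ_sum_smul, ← germ_zero hxV] at hr
  obtain ⟨W, hW, hxW, h⟩ := exists_res_eq_of_germ_eq hxV hr
  have h1 := (he W (hW.trans hV)).1 (a₁ := fun i => (PSpace n).presheaf.map (homOfLE hW).op (t i))
    (a₂ := 0) (by
      simp only [map_sum, res_smul, res_res, map_zero] at h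
      simpa using h)
  intro i
  rw [← ht, ← TopCat.Presheaf.germ_res_apply _ (homOfLE hW) x hxW, congrFun h1 i]
  exact map_zero _

theorem span_germ {e : ι → Γ(M, U)} (he : IsFrame M U e) (hx : x ∈ U) :
    Submodule.span ((PSpace n).presheaf.stalk x) (Set.range fun i => germ M U x hx (e i)) = ⊤ := by
  rw [eq_top_iff]
  rintro m -
  obtain ⟨V, hV, hxV, s, rfl⟩ := TopCat.Presheaf.exists_le_germ_eq (C := Ab) M.presheaf m hx
  obtain ⟨c, hc⟩ := (he V hV).2 s
  change germ M V x hxV s ∈ _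
  rw [← hc]
  simp only
  rw [germ_sum_smul]
  refine Submodule.sum_mem _ fun i _ => Submodule.smul_mem _ _ (Submodule.subset_span ⟨i, ?_⟩)
  exact (germ_res hV hxV (e i)).symm

/-- The germs of a frame form a basis of the stalk. -/
def stalkBasis {e : ι → Γ(M, U)} (he : IsFrame M U e) (hx : x ∈ U) :
    Module.Basis ι ((PSpace n).presheaf.stalk x) (Stalk M x) :=
  Module.Basis.mk (he.linearIndependent_germ hx) (he.span_germ hx).ge

theorem stalkBasis_apply {e : ι → Γ(M, U)} (he : IsFrame M U e) (hx : x ∈ U) (i : ι) :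
    he.stalkBasis hx i = germ M U x hx (e i) :=
  Module.Basis.mk_apply _ _ i

/-- Sections whose germs at `x` form a basis of the stalk of a free module are a frame
near `x`. -/
theorem exists_of_germ_basis [DecidableEq ι] {e : ι → Γ(M, U)} (he : IsFrame M U e) (hx : x ∈ U)
    (b : Module.Basis ι ((PSpace n).presheaf.stalk x) (Stalk M x)) (g : ι → Γ(M, U))
    (hg : ∀ i, germ M U x hx (g i) = b i) :
    ∃ (W : (PSpace n).Opens) (hW : W ≤ U), x ∈ W ∧
      IsFrame M W fun i => CokernelBundles.res M hW (g i) := by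
  -- The matrix `A` of the `g j` in the frame `e` has as its germ at `x` a change of basis, so
  -- `A.det` is a unit at `x`; the required neighbourhood is the locus where `A.det` is invertible.
  choose P hP using fun j => (he U le_rfl).2 (g j)
  simp only [res_self] at hP
  let A : Matrix ι ι Γ(PSpace n, U) := fun i j => P j i
  have hgerm : (he.stalkBasis hx).toMatrix b =
      ((PSpace n).presheaf.germ U x hx).hom.mapMatrix A := by
    ext i j
    rw [Module.Basis.toMatrix_apply, ← hg, ← hP, germ_sum_smul]
    simp only [← he.stalkBasis_apply hx]
    rw [Module.Basis.repr_sum_self]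
    rfl
  have hdet : IsUnit ((PSpace n).presheaf.germ U x hx A.det) := by
    have := (he.stalkBasis hx).isUnit_det b
    rwa [Module.Basis.det_apply, hgerm, ← RingHom.map_det] at this
  refine ⟨(PSpace n).basicOpen A.det, (PSpace n).basicOpen_le _,
    ((PSpace n).mem_basicOpen _ x hx).2 hdet, fun W hW => ?_⟩
  have hWU := hW.trans ((PSpace n).basicOpen_le A.det)
  let A' : Matrix ι ι Γ(PSpace n, W) := ((PSpace n).presheaf.map (homOfLE hWU).op).hom.mapMatrix A
  have hA' : IsUnit A' := by
    rw [Matrix.isUnit_iff_isUnit_det, ← RingHom.map_det]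
    exact isUnit_map_of_le_basicOpen A.det hW hWU
  have hbij : Function.Bijective A'.mulVec :=
    ⟨Function.LeftInverse.injective (g := (A'⁻¹).mulVec) fun v => by
      rw [Matrix.mulVec_mulVec, Matrix.nonsing_inv_mul _ ((Matrix.isUnit_iff_isUnit_det _).1 hA'),
        Matrix.one_mulVec], Matrix.mulVec_surjective_iff_isUnit.2 hA'⟩
  have := (he W hWU).comp hbij
  refine (congrArg Function.Bijective (funext fun c => ?_)).mp this
  have h1 (j) : CokernelBundles.res M hWU (g j) =
      ∑ i, A' i j • CokernelBundles.res M hWU (e i) := by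
    rw [← hP, map_sum]
    simp only [res_smul]
    rfl
  simp only [res_res, h1, Function.comp, Matrix.mulVec, dotProduct, Finset.sum_smul,
    Finset.smul_sum]
  rw [Finset.sum_comm]
  simp only [smul_smul, mul_comm]

end IsFrame

end CokernelBundles

/-! ### Cokernels of maps between framed modules; injectivity on one fibre -/

namespace CokernelBundles

section Restrict

variable {X : Scheme.{0}}

theorem unitModule_hom_ext {M : X.Modules} {f g : unitModule X ⟶ M}
    (h : f.app ⊤ (toUnit 1) = g.app ⊤ (toUnit 1)) : f = g := by
  refine (SheafOfModules.unitHomEquiv (R := X.ringCatSheaf) M).injective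
    (PresheafOfModules.sections_ext _ _ fun U => ?_)
  have key (f : unitModule X ⟶ M) : f.app U.unop (toUnit 1) =
      res M le_top (f.app ⊤ (toUnit 1)) := by
    rw [← app_res]
    exact congrArg (f.app U.unop) (map_one (X.presheaf.map (homOfLE le_top).op).hom).symm
  exact (key f).trans ((congrArg _ h).trans (key g).symm)

theorem ofSection_comp {M N : X.Modules} (φ : M ⟶ N) (s : Γ(M, ⊤)) :
    ofSection s ≫ φ = ofSection (φ.app ⊤ s) :=
  unitModule_hom_ext (by
    rw [comp_app_apply, ofSection_app_one, ofSection_app_one, res_self, res_self])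

/-- If a morphism `α : M ⟶ N` maps a frame of `M` to a part of a frame of `N`, then the rest of
the latter is a frame of the cokernel of `α`. -/
theorem nonempty_cokernel_iso {ι κ : Type} [Fintype ι] [Fintype κ] {M N C : X.Modules}
    {α : M ⟶ N} {π : N ⟶ C} {w : α ≫ π = 0} (hC : IsColimit (CokernelCofork.ofπ π w))
    {e : ι → Γ(M, ⊤)} {g : ι ⊕ κ → Γ(N, ⊤)} (he : IsFrame M ⊤ e) (hg : IsFrame N ⊤ g)
    (h : ∀ i, g (Sum.inl i) = α.app ⊤ (e i)) : Nonempty (C ≅ freeModule X κ) := by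
  have := he.isIso_freeOfSections
  have := hg.isIso_freeOfSections
  let p : freeModule X (ι ⊕ κ) ⟶ freeModule X κ := freeDesc (Sum.elim (fun _ => 0) ιFreeModule)
  let j : freeModule X κ ⟶ freeModule X (ι ⊕ κ) := freeDesc fun k => ιFreeModule (Sum.inr k)
  have hjp : j ≫ p = 𝟙 _ := freeModule_hom_ext fun i => by
    rw [← Category.assoc, ιFreeModule_desc, ιFreeModule_desc, Category.comp_id, Sum.elim_inr]
  have hl (i) : ιFreeModule (Sum.inl i) ≫ freeOfSections g =
      ιFreeModule i ≫ freeOfSections e ≫ α := by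
    rw [← Category.assoc, freeOfSections, freeOfSections, ιFreeModule_desc, ιFreeModule_desc,
      ofSection_comp, h]
  -- In the frames, `α` is the inclusion of the `Sum.inl` summands, which `p` kills; hence `p`
  -- descends to `C`, with inverse induced by `j`.
  have hα : α ≫ inv (freeOfSections g) ≫ p = 0 := by
    rw [← cancel_epi (freeOfSections e), comp_zero]
    refine freeModule_hom_ext fun i => ?_
    have : (ιFreeModule i ≫ freeOfSections e ≫ α) ≫ inv (freeOfSections g) ≫ p = 0 := by
      rw [← hl, Category.assoc, IsIso.hom_inv_id_assoc, ιFreeModule_desc, Sum.elim_inl]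
    rw [comp_zero, ← this, Category.assoc, Category.assoc]
  have hepi : Epi π := Cofork.IsColimit.epi hC
  let v : C ⟶ freeModule X κ := Cofork.IsColimit.desc hC (inv (freeOfSections g) ≫ p)
    (by rw [hα, zero_comp])
  have hv : π ≫ v = inv (freeOfSections g) ≫ p := Cofork.IsColimit.π_desc' hC _ _
  refine ⟨v, j ≫ freeOfSections g ≫ π, ?_, ?_⟩
  · rw [← cancel_epi π, ← Category.assoc, hv, Category.comp_id, ← cancel_epi (freeOfSections g),
      Category.assoc, IsIso.hom_inv_id_assoc]
    refine freeModule_hom_ext fun i => ?_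
    rw [← Category.assoc, ιFreeModule_desc]
    rcases i with i | k
    · rw [Sum.elim_inl, zero_comp, ← Category.assoc, hl, Category.assoc, Category.assoc, w,
        comp_zero, comp_zero]
    · rw [Sum.elim_inr, ← Category.assoc, ιFreeModule_desc]
  · rw [Category.assoc, Category.assoc, hv, IsIso.hom_inv_id_assoc, hjp]

/-- Restriction to an open subset preserves cokernels, so the computation over the whole scheme
applies on `U`. -/
theorem nonempty_restrict_cokernel_iso {ι κ : Type} [Fintype ι] [Fintype κ] {M N : X.Modules}
    (α : M ⟶ N) {U : X.Opens}
    {e : ι → Γ(M, U)} {g : ι ⊕ κ → Γ(N, U)} (he : IsFrame M U e) (hg : IsFrame N U g)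
    (h : ∀ i, g (Sum.inl i) = α.app U (e i)) :
    Nonempty ((cokernel α).restrict U.ι ≅ freeModule U.toScheme κ) := by
  have w : (Scheme.Modules.restrictFunctor U.ι).map α ≫
      (Scheme.Modules.restrictFunctor U.ι).map (cokernel.π α) = 0 := by
    rw [← Functor.map_comp, cokernel.condition, Functor.map_zero]
  refine nonempty_cokernel_iso (w := w) (CokernelCofork.mapIsColimit _ (cokernelIsCokernel α)
    (Scheme.Modules.restrictFunctor U.ι)) he.restrict hg.restrict fun i => ?_
  rw [h]
  exact (app_res α _ _).symm

end Restrict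

section Fibres

variable {n : ℕ} {M N : (PSpace n).Modules} {U V : (PSpace n).Opens} {x : PSpace n}
  {ι κ : Type} [Fintype ι] [Fintype κ]

theorem fibreMap_injective_iff (α : M ⟶ N) (x : PSpace n) :
    Function.Injective (fibreMap α x) ↔ ∀ y, stalkMap α x y ∈
      IsLocalRing.maximalIdeal ((PSpace n).presheaf.stalk x) •
        (⊤ : Submodule ((PSpace n).presheaf.stalk x) (Stalk N x)) → y ∈
      IsLocalRing.maximalIdeal ((PSpace n).presheaf.stalk x) •
        (⊤ : Submodule ((PSpace n).presheaf.stalk x) (Stalk M x)) := by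
  rw [injective_iff_map_eq_zero]
  refine ⟨fun h y hy => ?_, fun h z hz => ?_⟩
  · rw [← Submodule.Quotient.mk_eq_zero]
    exact h _ ((Submodule.Quotient.mk_eq_zero _).2 hy)
  · obtain ⟨y, rfl⟩ := Submodule.Quotient.mk_surjective _ z
    exact (Submodule.Quotient.mk_eq_zero _).2 (h y ((Submodule.Quotient.mk_eq_zero _).1 hz))

theorem IsFrame.stalkMap_stalkBasis {e : ι → Γ(M, U)} (he : IsFrame M U e) (hx : x ∈ U)
    (α : M ⟶ N) (i : ι) :
    stalkMap α x (he.stalkBasis hx i) = germ N U x hx (α.app U (e i)) := by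
  rw [he.stalkBasis_apply hx]
  exact stalkAddHom_germ α U x hx (e i)

theorem fibreMap_injective_of_isFrame (α : M ⟶ N) {e : ι → Γ(M, U)} {g : ι ⊕ κ → Γ(N, U)}
    (he : IsFrame M U e) (hg : IsFrame N U g) (h : ∀ i, g (Sum.inl i) = α.app U (e i))
    (hx : x ∈ U) : Function.Injective (fibreMap α x) := by
  rw [fibreMap_injective_iff]
  refine fun y hy => mem_smul_top_of_basis_extending (he.stalkBasis hx) (hg.stalkBasis hx)
    (stalkMap α x) (fun i => ?_) hy
  rw [he.stalkMap_stalkBasis, hg.stalkBasis_apply, h]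

/-- `exists_basis_extending` solves the problem on the stalk, and `exists_of_germ_basis` spreads the
solution to a neighbourhood. The cardinality identity determines the rank of the cokernel. -/
theorem exists_isFrame_extending (α : M ⟶ N) {e : ι → Γ(M, U)} {f : κ → Γ(N, U)}
    (he : IsFrame M U e) (hf : IsFrame N U f) (hx : x ∈ U)
    (hα : Function.Injective (fibreMap α x)) :
    ∃ (s : ℕ) (V : (PSpace n).Opens) (hV : V ≤ U) (g : ι ⊕ Fin s → Γ(N, V)), x ∈ V ∧
      IsFrame N V g ∧ (∀ i, g (Sum.inl i) = α.app V (res M hV (e i))) ∧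
      Fintype.card κ = Fintype.card ι + s := by
  classical
  obtain ⟨s, b, hb⟩ := exists_basis_extending (he.stalkBasis hx) (hf.stalkBasis hx) (stalkMap α x)
    ((fibreMap_injective_iff α x).1 hα)
  obtain ⟨V, hV, hxV, t, ht⟩ := exists_lift_germs (C := Ab) N.presheaf hx (fun j => b (Sum.inr j))
  let g : ι ⊕ Fin s → Γ(N, V) := Sum.elim (fun i => α.app V (res M hV (e i))) t
  have hg (j) : germ N V x hxV (g j) = b j := by
    rcases j with i | j
    · rw [hb, he.stalkMap_stalkBasis, ← germ_res hV hxV, ← app_res]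
      rfl
    · exact ht j
  let σ := (hf.stalkBasis hx).indexEquiv b
  obtain ⟨W, hW, hxW, hgW⟩ := ((hf.res hV).reindex σ.symm).exists_of_germ_basis hxV b g hg
  refine ⟨s, W, hW.trans hV, _, hxW, hgW, fun i => ?_, ?_⟩
  · change res N hW (α.app V (res M hV (e i))) = _
    rw [← app_res, res_res]
  · rw [Fintype.card_congr σ, Fintype.card_sum, Fintype.card_fin]

end Fibres

end CokernelBundles

/-! ### Epimorphisms, left exactness of sections, closed points -/

namespace CokernelBundles

section Epi

universe u

variable {C : Type u} [SmallCategory C] {J : GrothendieckTopology C} {R : Sheaf J RingCat.{u}}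
  [HasSheafify J AddCommGrpCat.{u}] [J.WEqualsLocallyBijective AddCommGrpCat.{u}]

/-- An epimorphism of sheaves of modules is an epimorphism of the underlying sheaves of abelian
groups. -/
theorem epi_toSheaf_map {M N : SheafOfModules.{u} R} (f : M ⟶ N) [Epi f] :
    Epi ((SheafOfModules.toSheaf R).map f) := by
  -- Up to the invertible counit, `f` is the sheafification of the presheaf map `g`. Factor `g`
  -- through its presheaf image: the sheafified inclusion is mono and epi, hence invertible, and the
  -- sheafified surjection is epi on abelian sheaves.
  let a := PresheafOfModules.sheafification.{u} (𝟙 R.obj)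
  let adj := PresheafOfModules.sheafificationAdjunction.{u} (𝟙 R.obj)
  let g := (SheafOfModules.forget R ⋙ PresheafOfModules.restrictScalars (𝟙 R.obj)).map f
  have hnat : a.map g ≫ adj.counit.app N = adj.counit.app M ≫ f := adj.counit.naturality f
  have hg : Epi (a.map g) := by
    have : a.map g = adj.counit.app M ≫ f ≫ inv (adj.counit.app N) := by
      rw [← Category.assoc, ← hnat, Category.assoc, IsIso.hom_inv_id, Category.comp_id]
    rw [this]
    infer_instance
  have hfac : a.map (Abelian.factorThruImage g) ≫ a.map (Abelian.image.ι g) = a.map g := by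
    rw [← Functor.map_comp, Abelian.image.fac]
  have h1 : Epi (a.map (Abelian.image.ι g)) := epi_of_epi_fac hfac
  have h2 : Mono (a.map (Abelian.image.ι g)) := inferInstance
  have h3 : IsIso (a.map (Abelian.image.ι g)) := isIso_of_mono_of_epi _
  have h4 : Epi ((SheafOfModules.toSheaf R).map (a.map (Abelian.factorThruImage g))) :=
    inferInstanceAs (Epi ((PresheafOfModules.toPresheaf _ ⋙
      presheafToSheaf J AddCommGrpCat.{u}).map (Abelian.factorThruImage g)))
  have h5 : f = inv (adj.counit.app M) ≫ a.map (Abelian.factorThruImage g) ≫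
      a.map (Abelian.image.ι g) ≫ adj.counit.app N := by
    rw [← Category.assoc (a.map _), hfac, hnat, IsIso.inv_hom_id_assoc]
  rw [h5]
  simp only [Functor.map_comp]
  infer_instance

end Epi

variable {X : Scheme.{0}}

theorem exists_app_eq_of_epi {M N : X.Modules} (π : M ⟶ N) [Epi π] {U : X.Opens} {x : X}
    (hx : x ∈ U) (t : Γ(N, U)) :
    ∃ (V : X.Opens) (hV : V ≤ U) (s : Γ(M, V)), x ∈ V ∧ π.app V s = res N hV t := by
  have h : Epi ((SheafOfModules.toSheaf X.ringCatSheaf).map π) :=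
    @epi_toSheaf_map _ _ _ X.ringCatSheaf _ _ M N π ‹_›
  obtain ⟨V, hV, ⟨s, hs⟩, hxV⟩ := (TopCat.Presheaf.isLocallySurjective_iff _).1
    ((TopCat.Sheaf.isLocallySurjective_iff_epi _).2 h) U t x hx
  exact ⟨V, hV, s, hxV, hs⟩

/-- The sections of an `𝒪`-module over an open subset, as a functor to abelian groups. -/
def sectionsFunctor (U : X.Opens) : X.Modules ⥤ Ab.{0} :=
  Scheme.Modules.toPresheaf X ⋙ (evaluation _ _).obj (op U)

instance (U : X.Opens) : PreservesFiniteLimits (sectionsFunctor U) :=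
  have : PreservesFiniteLimits (Scheme.Modules.toPresheaf X) :=
    PreservesLimits.preservesFiniteLimits _
  have : PreservesFiniteLimits ((evaluation (Opens X)ᵒᵖ Ab.{0}).obj (op U)) := inferInstance
  comp_preservesFiniteLimits _ _

instance (U : X.Opens) : (sectionsFunctor U).Additive where
  map_add := rfl

theorem app_injective_of_mono {M N : X.Modules} (α : M ⟶ N) [Mono α] (U : X.Opens) :
    Function.Injective (α.app U) :=
  (AddCommGrpCat.mono_iff_injective _).1 (inferInstanceAs (Mono ((sectionsFunctor U).map α)))

/-- Taking sections over `U` is left exact. -/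
theorem exists_app_eq_of_app_eq_zero {S : ShortComplex X.Modules} (hS : S.ShortExact)
    {U : X.Opens} {t : Γ(S.X₂, U)} (ht : S.g.app U t = 0) : ∃ s, S.f.app U s = t := by
  have := hS.mono_f
  have h := hS.exact.map_of_mono_of_preservesKernel (sectionsFunctor U) inferInstance inferInstance
  exact (ShortComplex.ab_exact_iff _).1 h t ht

theorem eq_of_locally_eq (M : X.Modules) {U : X.Opens} {s t : Γ(M, U)}
    (h : ∀ x ∈ U, ∃ (V : X.Opens) (hV : V ≤ U), x ∈ V ∧ res M hV s = res M hV t) : s = t := by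
  choose V hV hxV hst using fun x : U => h x.1 x.2
  exact TopCat.Sheaf.eq_of_locally_eq' (C := Ab.{0}) ⟨M.presheaf, M.isSheaf⟩ V U
    (fun x => homOfLE (hV x))
    (fun x hx => Opens.mem_iSup.2 ⟨⟨x, hx⟩, hxV _⟩) s t hst

theorem mono_of_app_injective {M N : X.Modules} (α : M ⟶ N)
    (h : ∀ U, Function.Injective (α.app U)) : Mono α where
  right_cancellation f g hfg := by
    ext U s
    exact h U (congr(($hfg).app U s))

-- The affine charts of the finitely many variables cover, because the variables generate the
-- polynomial ring over its degree-zero part. Compactness is what provides closed points in closed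
-- subsets.
attribute [local instance] MvPolynomial.gradedAlgebra in
instance compactSpace_pSpace (n : ℕ) : CompactSpace (PSpace n) := by
  let 𝒜 := MvPolynomial.homogeneousSubmodule (Fin (n + 1)) ℂ
  have hcov : ⨆ i : Fin (n + 1), Proj.basicOpen 𝒜 (MvPolynomial.X i) = ⊤ := by
    refine Proj.iSup_basicOpen_eq_top' 𝒜 _ (fun i => ⟨1, MvPolynomial.isHomogeneous_X _ i⟩) ?_
    refine eq_top_iff.2 fun p _ => ?_
    induction p using MvPolynomial.induction_on with
    | C a =>
      let a' : 𝒜 0 := ⟨MvPolynomial.C a, MvPolynomial.isHomogeneous_C _ a⟩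
      exact (Algebra.adjoin (𝒜 0) _).algebraMap_mem a'
    | add p q hp hq => exact Subalgebra.add_mem _ (hp trivial) (hq trivial)
    | mul_X p i hp => exact Subalgebra.mul_mem _ (hp trivial) (Algebra.subset_adjoin ⟨i, rfl⟩)
  have hc (i) : IsCompact (Proj.basicOpen 𝒜 (MvPolynomial.X i) : Set (Proj 𝒜)) :=
    (Proj.isAffineOpen_basicOpen 𝒜 (MvPolynomial.X i) (MvPolynomial.isHomogeneous_X _ i)
      one_pos).isCompact
  have := isCompact_iUnion hc
  rw [← Opens.coe_iSup, hcov] at this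
  exact ⟨this⟩

/-- Every point of `ℙⁿ` specializes to a closed point. -/
theorem exists_isClosed_singleton_specializes {n : ℕ} (x : PSpace n) :
    ∃ P : PSpace n, IsClosed {P} ∧ x ⤳ P := by
  obtain ⟨P, hP, hcl⟩ := (isClosed_closure (s := {x})).exists_closed_singleton
    ⟨x, subset_closure rfl⟩
  exact ⟨P, hcl, specializes_iff_mem_closure.2 hP⟩

end CokernelBundles

/-! ### Fibrewise injectivity and locally free cokernels -/

namespace CokernelBundles

variable {n : ℕ} {E F : (PSpace n).Modules} {rE rF a b : ℕ}

theorem IsVectorBundle.exists_isFrame {M : (PSpace n).Modules} {r : ℕ} (hM : IsVectorBundle M r)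
    (x : PSpace n) :
    ∃ (U : (PSpace n).Opens) (e : Fin r → Γ(M, U)), x ∈ U ∧ IsFrame M U e := by
  obtain ⟨U, hx, ⟨φ⟩⟩ := hM x
  obtain ⟨e, he⟩ := CokernelBundles.exists_isFrame φ
  exact ⟨U, e, hx, he⟩

theorem IsFrame.power {U : (PSpace n).Opens} {ι : Type} [Fintype ι] {e : ι → Γ(E, U)}
    (he : IsFrame E U e) (a : ℕ) :
    IsFrame (power E a) U fun x : Fin a × ι =>
      (biproduct.ι (fun _ : Fin a => E) x.1).app U (e x.2) :=
  he.biproduct _ (biproduct.π (fun _ : Fin a => E)) (fun j k => by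
    rw [biproduct.ι_π]
    rfl) biproduct.total

/-- A morphism `E^a ⟶ F^b` that is injective on the fibres at closed points is locally the
inclusion of a part of a frame. -/
theorem exists_isFrame_extending_power (hE : IsVectorBundle E rE) (hF : IsVectorBundle F rF)
    (α : power E a ⟶ power F b)
    (hα : ∀ P : PSpace n, IsClosed {P} → Function.Injective (fibreMap α P)) (x : PSpace n) :
    ∃ (s : ℕ) (U : (PSpace n).Opens) (e : Fin a × Fin rE → Γ(power E a, U))
      (g : (Fin a × Fin rE) ⊕ Fin s → Γ(power F b, U)), x ∈ U ∧ IsFrame _ U e ∧ IsFrame _ U g ∧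
      (∀ i, g (Sum.inl i) = α.app U (e i)) ∧ b * rF = a * rE + s := by
  -- The frames are built at a closed specialization `P` of `x`; every open neighbourhood of `P`
  -- contains `x`.
  obtain ⟨P, hP, hxP⟩ := exists_isClosed_singleton_specializes x
  obtain ⟨U, e, hPU, he⟩ := hE.exists_isFrame P
  obtain ⟨V, f, hPV, hf⟩ := hF.exists_isFrame P
  have he' := (he.res (inf_le_left : U ⊓ V ≤ U)).power a
  have hf' := (hf.res (inf_le_right : U ⊓ V ≤ V)).power b
  obtain ⟨s, W, hW, g, hPW, hg, hge, hs⟩ := exists_isFrame_extending α he' hf' ⟨hPU, hPV⟩ (hα P hP)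
  exact ⟨s, W, _, g, hxP.mem_open W.2 hPW, he'.res hW, hg, hge, by simpa using hs⟩

theorem mono_of_fibreMap_injective (hE : IsVectorBundle E rE) (hF : IsVectorBundle F rF)
    (α : power E a ⟶ power F b)
    (hα : ∀ P : PSpace n, IsClosed {P} → Function.Injective (fibreMap α P)) : Mono α := by
  refine mono_of_app_injective α fun U => (injective_iff_map_eq_zero (α.app U).hom).2 fun s hs => ?_
  refine eq_of_locally_eq _ fun x hx => ?_
  obtain ⟨k, V, e, g, hxV, he, hg, hge, -⟩ := exists_isFrame_extending_power hE hF α hα x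
  refine ⟨U ⊓ V, inf_le_left, ⟨hx, hxV⟩, ?_⟩
  obtain ⟨c, hc⟩ := (he (U ⊓ V) inf_le_right).2 (res _ inf_le_left s)
  have h0 : α.app (U ⊓ V) (res _ inf_le_left s) = 0 := by
    rw [app_res]
    exact (congrArg _ hs).trans (map_zero _)
  -- The coordinates of `s` in `e`, extended by zero, are those of its image in the frame `g`; the
  -- image vanishes, so they do.
  have h1 : Sum.elim c 0 = (0 : _ ⊕ Fin k → Γ(PSpace n, U ⊓ V)) := (hg (U ⊓ V) inf_le_right).1 (by
    simp only [Fintype.sum_sum_type, Sum.elim_inl, Sum.elim_inr, Pi.zero_apply, zero_smul,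
      Finset.sum_const_zero, add_zero]
    rw [← h0, ← hc]
    simp only [map_sum, Scheme.Modules.Hom.app_smul, hge, app_res])
  rw [map_zero, ← hc]
  exact Finset.sum_eq_zero fun i _ => by rw [show c i = 0 from congrFun h1 (Sum.inl i), zero_smul]

theorem isVectorBundle_cokernel (hE : IsVectorBundle E rE) (hF : IsVectorBundle F rF)
    (α : power E a ⟶ power F b)
    (hα : ∀ P : PSpace n, IsClosed {P} → Function.Injective (fibreMap α P)) :
    IsVectorBundle (cokernel α) (b * rF - a * rE) := by
  intro x
  obtain ⟨k, U, e, g, hxU, he, hg, hge, hk⟩ := exists_isFrame_extending_power hE hF α hα x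
  -- By `hk` the natural-number subtraction is not truncated, and `k` is the same at all points.
  obtain rfl : k = b * rF - a * rE := by omega
  exact ⟨U, hxU, nonempty_restrict_cokernel_iso α he hg hge⟩

/-- In a short exact sequence, a frame of the middle term is obtained from one of the
subobject and lifts of one of the quotient. -/
theorem isFrame_of_shortExact {X : Scheme.{0}} {S : ShortComplex X.Modules} (hS : S.ShortExact)
    {U : X.Opens} {ι κ : Type} [Fintype ι] [Fintype κ] {e : ι → Γ(S.X₁, U)} {c : κ → Γ(S.X₃, U)}
    (he : IsFrame S.X₁ U e) (hc : IsFrame S.X₃ U c) (t : κ → Γ(S.X₂, U))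
    (ht : ∀ k, S.g.app U (t k) = c k) :
    IsFrame S.X₂ U (Sum.elim (fun i => S.f.app U (e i)) t) := by
  intro V hV
  have := hS.mono_f
  have hfg (s : Γ(S.X₁, V)) : S.g.app V (S.f.app V s) = 0 := congr(($(S.zero)).app V s)
  have hsum (d : ι ⊕ κ → Γ(X, V)) :
      ∑ i, d i • res S.X₂ hV (Sum.elim (fun i => S.f.app U (e i)) t i) =
        S.f.app V (∑ i, d (Sum.inl i) • res S.X₁ hV (e i)) +
          ∑ k, d (Sum.inr k) • res S.X₂ hV (t k) := by
    simp only [Fintype.sum_sum_type, Sum.elim_inl, Sum.elim_inr, map_sum,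
      Scheme.Modules.Hom.app_smul, app_res]
  have hg (d : κ → Γ(X, V)) : S.g.app V (∑ k, d k • res S.X₂ hV (t k)) =
      ∑ k, d k • res S.X₃ hV (c k) := by
    simp only [map_sum, Scheme.Modules.Hom.app_smul, app_res, ht]
  constructor
  · intro d d' h
    simp only [hsum] at h
    have h2 := congrArg (S.g.app V) h
    rw [map_add, map_add, hfg, hfg, zero_add, zero_add, hg, hg] at h2
    have h3 : (fun k => d (Sum.inr k)) = fun k => d' (Sum.inr k) := (hc V hV).1 h2
    simp only [fun k => congrFun h3 k] at h
    have h4 : (fun k => d (Sum.inl k)) = fun k => d' (Sum.inl k) :=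
      (he V hV).1 (app_injective_of_mono S.f V (add_right_cancel h))
    funext j
    exact j.rec (congrFun h4) (congrFun h3)
  · intro s
    obtain ⟨d, hd⟩ := (hc V hV).2 (S.g.app V s)
    obtain ⟨u, hu⟩ := exists_app_eq_of_app_eq_zero hS (U := V)
      (t := s - ∑ k, d k • res S.X₂ hV (t k)) (by rw [map_sub, hg, ← hd, sub_self])
    obtain ⟨d', hd'⟩ := (he V hV).2 u
    refine ⟨Sum.elim d' d, ?_⟩
    refine (hsum _).trans ?_
    simp only [Sum.elim_inl, Sum.elim_inr]
    rw [show ∑ i, d' i • res S.X₁ hV (e i) = u from hd', hu, sub_add_cancel]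

/-- The epimorphism `S.g` is locally surjective, so the frame of the quotient lifts near `x`; the
lifts complete the image of `e` to a frame of the middle term. -/
theorem fibreMap_injective_of_shortExact {S : ShortComplex (PSpace n).Modules} (hS : S.ShortExact)
    {ι κ : Type} [Fintype ι] [Fintype κ] (x : PSpace n)
    {U V : (PSpace n).Opens} {e : ι → Γ(S.X₁, U)} {c : κ → Γ(S.X₃, V)} (hx : x ∈ U) (hx' : x ∈ V)
    (he : IsFrame S.X₁ U e) (hc : IsFrame S.X₃ V c) :
    Function.Injective (fibreMap S.f x) := by
  have := hS.epi_g
  choose W hW t hxW ht using fun k => exists_app_eq_of_epi S.g hx' (c k)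
  obtain ⟨W', hW', hxW', hle⟩ := exists_le_of_finite (U := U ⊓ V) ⟨hx, hx'⟩ W hxW
  refine fibreMap_injective_of_isFrame S.f (he.res (hW'.trans inf_le_left))
    (isFrame_of_shortExact hS (he.res (hW'.trans inf_le_left)) (hc.res (hW'.trans inf_le_right))
      (fun k => res S.X₂ (hle k) (t k)) fun k => ?_) (fun i => rfl) hxW'
  rw [app_res, ht, res_res]

end CokernelBundles

/-! ### Fibres of `V ⊗ E` -/

namespace CokernelBundles

section FibreLinear

variable {n : ℕ} {M N K : (PSpace n).Modules} (x : PSpace n)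

theorem germ_const {U : (PSpace n).Opens} (hx : x ∈ U) (c : ℂ) :
    (PSpace n).presheaf.germ U x hx (const U c) = constStalk x c := by
  rw [← const_map (homOfLE le_top) c, TopCat.Presheaf.germ_res_apply]
  rfl

theorem exists_germ_eq (m : Stalk M x) :
    ∃ (U : (PSpace n).Opens) (hx : x ∈ U) (s : Γ(M, U)), germ M U x hx s = m :=
  TopCat.Presheaf.exists_germ_eq (C := Ab) M.presheaf m

theorem stalkMap_germ (φ : M ⟶ N) {U : (PSpace n).Opens} (hx : x ∈ U) (s : Γ(M, U)) :
    stalkMap φ x (germ M U x hx s) = germ N U x hx (φ.app U s) :=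
  stalkAddHom_germ φ U x hx s

theorem stalkMap_add (φ ψ : M ⟶ N) (m : Stalk M x) :
    stalkMap (φ + ψ) x m = stalkMap φ x m + stalkMap ψ x m := by
  obtain ⟨U, hx, s, rfl⟩ := exists_germ_eq x m
  rw [stalkMap_germ, stalkMap_germ, stalkMap_germ, ← germ_add]
  rfl

theorem stalkMap_smul (c : ℂ) (φ : M ⟶ N) (m : Stalk M x) :
    stalkMap (c • φ) x m = constStalk x c • stalkMap φ x m := by
  obtain ⟨U, hx, s, rfl⟩ := exists_germ_eq x m
  rw [stalkMap_germ, stalkMap_germ, ← germ_const x hx, ← germ_smul]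
  rfl

theorem stalkMap_comp (φ : M ⟶ N) (ψ : N ⟶ K) (m : Stalk M x) :
    stalkMap (φ ≫ ψ) x m = stalkMap ψ x (stalkMap φ x m) := by
  obtain ⟨U, hx, s, rfl⟩ := exists_germ_eq x m
  rw [stalkMap_germ, stalkMap_germ, stalkMap_germ]
  rfl

theorem stalkMap_id (m : Stalk M x) : stalkMap (𝟙 M) x m = m := by
  obtain ⟨U, hx, s, rfl⟩ := exists_germ_eq x m
  rw [stalkMap_germ]
  rfl

/-- The fibre, with its structure of a complex vector space only. -/
def FibreSpace (M : (PSpace n).Modules) (x : PSpace n) : Type := Fibre M x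

instance : AddCommGroup (FibreSpace M x) := inferInstanceAs (AddCommGroup (Fibre M x))

instance : Module ℂ (FibreSpace M x) := inferInstanceAs (Module ℂ (Fibre M x))

/-- The class of a germ in the fibre. -/
def FibreSpace.mk (m : Stalk M x) : FibreSpace M x := Submodule.Quotient.mk m

theorem FibreSpace.mk_surjective : Function.Surjective (FibreSpace.mk (M := M) x) :=
  Submodule.Quotient.mk_surjective _

/-- The linear map induced on fibres. -/
def fibreSpaceMap (φ : M ⟶ N) : FibreSpace M x →ₗ[ℂ] FibreSpace N x := fibreMap φ x

theorem fibreSpaceMap_mk (φ : M ⟶ N) (m : Stalk M x) :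
    fibreSpaceMap x φ (FibreSpace.mk x m) = FibreSpace.mk x (stalkMap φ x m) := rfl

theorem FibreSpace.mk_add (m m' : Stalk M x) :
    FibreSpace.mk x (m + m') = FibreSpace.mk x m + FibreSpace.mk x m' := rfl

theorem FibreSpace.mk_smul (c : ℂ) (m : Stalk M x) :
    FibreSpace.mk x (constStalk x c • m) = c • FibreSpace.mk x m := rfl

theorem fibreSpaceMap_comp (φ : M ⟶ N) (ψ : N ⟶ K) :
    fibreSpaceMap x (φ ≫ ψ) = fibreSpaceMap x ψ ∘ₗ fibreSpaceMap x φ := by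
  refine LinearMap.ext fun m => ?_
  obtain ⟨y, rfl⟩ := FibreSpace.mk_surjective x m
  rw [LinearMap.comp_apply, fibreSpaceMap_mk, fibreSpaceMap_mk, fibreSpaceMap_mk, stalkMap_comp]

theorem fibreSpaceMap_id : fibreSpaceMap x (𝟙 M) = LinearMap.id := by
  refine LinearMap.ext fun m => ?_
  obtain ⟨y, rfl⟩ := FibreSpace.mk_surjective x m
  rw [fibreSpaceMap_mk, stalkMap_id, LinearMap.id_apply]

/-- The fibre map depends linearly on the morphism. -/
def fibreMapHom (M N : (PSpace n).Modules) :
    (M ⟶ N) →ₗ[ℂ] FibreSpace M x →ₗ[ℂ] FibreSpace N x where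
  toFun φ := fibreSpaceMap x φ
  map_add' φ ψ := by
    refine LinearMap.ext fun m => ?_
    obtain ⟨y, rfl⟩ := FibreSpace.mk_surjective x m
    rw [LinearMap.add_apply, fibreSpaceMap_mk, stalkMap_add, FibreSpace.mk_add]
    rfl
  map_smul' c φ := by
    refine LinearMap.ext fun m => ?_
    obtain ⟨y, rfl⟩ := FibreSpace.mk_surjective x m
    rw [LinearMap.smul_apply, fibreSpaceMap_mk, stalkMap_smul, FibreSpace.mk_smul]
    rfl

theorem fibreSpaceMap_sum {κ : Type} (t : Finset κ) (φ : κ → (M ⟶ N)) :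
    fibreSpaceMap x (∑ k ∈ t, φ k) = ∑ k ∈ t, fibreSpaceMap x (φ k) :=
  map_sum (fibreMapHom x M N) φ t

theorem fibreSpaceMap_smul (c : ℂ) (φ : M ⟶ N) :
    fibreSpaceMap x (c • φ) = c • fibreSpaceMap x φ :=
  map_smul (fibreMapHom x M N) c φ

theorem fibreSpaceMap_zero : fibreSpaceMap x (0 : M ⟶ N) = 0 :=
  map_zero (fibreMapHom x M N)

end FibreLinear

section FibreTensor

variable {n : ℕ} {E F : (PSpace n).Modules} (x : PSpace n)
  (V W : Type) [AddCommGroup V] [Module ℂ V] [FiniteDimensional ℂ V]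
  [AddCommGroup W] [Module ℂ W] [FiniteDimensional ℂ W]

/-- The canonical isomorphism `V ⊗ E_x ≃ (V ⊗ E)_x`. -/
def fibreTensorEquiv (E : (PSpace n).Modules) :
    V ⊗[ℂ] FibreSpace E x ≃ₗ[ℂ] FibreSpace (vtensor V E) x :=
  LinearEquiv.ofLinearMap
    (TensorProduct.lift ((Module.finBasis ℂ V).constr ℂ fun j =>
      fibreSpaceMap x (biproduct.ι (fun _ => E) j)))
    (∑ j, TensorProduct.mk ℂ V (FibreSpace E x) (Module.finBasis ℂ V j) ∘ₗ
      fibreSpaceMap x (biproduct.π (fun _ => E) j))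
    (by
      rw [← fibreSpaceMap_id, ← biproduct.total, fibreSpaceMap_sum]
      refine LinearMap.ext fun m => ?_
      simp [LinearMap.sum_apply, fibreSpaceMap_comp])
    (by
      refine TensorProduct.ext ((Module.finBasis ℂ V).ext fun j => LinearMap.ext fun m => ?_)
      change (∑ l, TensorProduct.mk ℂ V (FibreSpace E x) (Module.finBasis ℂ V l) ∘ₗ
        fibreSpaceMap x (biproduct.π (fun _ => E) l)) (TensorProduct.lift
          ((Module.finBasis ℂ V).constr ℂ fun j => fibreSpaceMap x (biproduct.ι (fun _ => E) j))
          (Module.finBasis ℂ V j ⊗ₜ[ℂ] m)) = Module.finBasis ℂ V j ⊗ₜ[ℂ] m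
      simp only [TensorProduct.mk_apply, LinearMap.comp_apply,
        TensorProduct.lift.tmul, Module.Basis.constr_basis, LinearMap.sum_apply]
      rw [Finset.sum_eq_single j]
      · rw [← LinearMap.comp_apply, ← fibreSpaceMap_comp, biproduct.ι_π_self, fibreSpaceMap_id,
          LinearMap.id_apply]
      · intro k _ hk
        rw [← LinearMap.comp_apply, ← fibreSpaceMap_comp, biproduct.ι_π_ne _ hk.symm,
          fibreSpaceMap_zero, LinearMap.zero_apply, TensorProduct.tmul_zero]
      · simp)

variable {V W}

theorem fibreTensorEquiv_basis_tmul (j : Fin (Module.finrank ℂ V)) (m : FibreSpace E x) :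
    fibreTensorEquiv x V E (Module.finBasis ℂ V j ⊗ₜ m) =
      fibreSpaceMap x (biproduct.ι (fun _ => E) j) m := by
  simp [fibreTensorEquiv]

theorem fibreTensorEquiv_tmul (v : V) (m : FibreSpace E x) :
    fibreTensorEquiv x V E (v ⊗ₜ m) =
      ∑ j, (Module.finBasis ℂ V).repr v j • fibreSpaceMap x (biproduct.ι (fun _ => E) j) m := by
  refine (congrArg (fun u => fibreTensorEquiv x V E (u ⊗ₜ m))
    ((Module.finBasis ℂ V).sum_repr v)).symm.trans ?_
  simp only [TensorProduct.sum_tmul, ← TensorProduct.smul_tmul', map_sum, map_smul,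
    fibreTensorEquiv_basis_tmul]

theorem fibreSpaceMap_vtensorMap (f : V →ₗ[ℂ] W) (φ : E ⟶ F) :
    fibreSpaceMap x (vtensorMap f φ) ∘ₗ (fibreTensorEquiv x V E).toLinearMap =
      (fibreTensorEquiv x W F).toLinearMap ∘ₗ TensorProduct.map f (fibreSpaceMap x φ) := by
  refine TensorProduct.ext ((Module.finBasis ℂ V).ext fun j => LinearMap.ext fun m => ?_)
  have h : biproduct.ι (fun _ => E) j ≫ vtensorMap f φ =
      ∑ l, LinearMap.toMatrix (Module.finBasis ℂ V) (Module.finBasis ℂ W) f l j •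
        (φ ≫ biproduct.ι (fun _ => F) l) := by
    rw [vtensorMap, biproduct.ι_matrix, biproduct.lift_eq]
    simp only [Linear.smul_comp]
  change fibreSpaceMap x (vtensorMap f φ)
      (fibreTensorEquiv x V E (Module.finBasis ℂ V j ⊗ₜ[ℂ] m)) =
    fibreTensorEquiv x W F (f (Module.finBasis ℂ V j) ⊗ₜ[ℂ] fibreSpaceMap x φ m)
  rw [fibreTensorEquiv_basis_tmul, fibreTensorEquiv_tmul]
  rw [← LinearMap.comp_apply, ← fibreSpaceMap_comp, h, fibreSpaceMap_sum, LinearMap.sum_apply]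
  refine Finset.sum_congr rfl fun l _ => ?_
  rw [fibreSpaceMap_smul, fibreSpaceMap_comp, LinearMap.toMatrix_apply]
  rfl

/-- The isomorphisms `fibreTensorEquiv` carry `∑ A_i ⊗ σ_i(P)` to the fibre of `alpha σ A` at `P`,
which the local criterion handles. -/
theorem isGloballyInjective_iff {w : ℕ} (σ : Module.Basis (Fin w) ℂ (E ⟶ F))
    (A : KroneckerRep w) : isGloballyInjective σ A ↔
      ∀ P : PSpace n, IsClosed {P} → Function.Injective (fibreMap (alpha σ A) P) := by
  refine forall₂_congr fun P _ => ?_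
  have h : fibreSpaceMap P (alpha σ A) ∘ₗ (fibreTensorEquiv P A.V E).toLinearMap =
      (fibreTensorEquiv P A.W F).toLinearMap ∘ₗ
        ∑ i, TensorProduct.map (A.map i) (fibreSpaceMap P (σ i)) := by
    refine LinearMap.ext fun t => ?_
    rw [alpha, fibreSpaceMap_sum]
    simp only [LinearMap.comp_apply, LinearMap.sum_apply, map_sum]
    exact Finset.sum_congr rfl fun i _ =>
      LinearMap.congr_fun (fibreSpaceMap_vtensorMap P (A.map i) (σ i)) t
  change Function.Injective (∑ i, TensorProduct.map (A.map i) (fibreSpaceMap P (σ i)) :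
    A.V ⊗[ℂ] FibreSpace E P →ₗ[ℂ] A.W ⊗[ℂ] FibreSpace F P) ↔
      Function.Injective (fibreSpaceMap P (alpha σ A))
  rw [← (fibreTensorEquiv P A.W F).injective.of_comp_iff,
    ← Function.Injective.of_comp_iff' _ (fibreTensorEquiv P A.V E).bijective]
  exact iff_of_eq (congrArg Function.Injective (congrArg DFunLike.coe h).symm)

end FibreTensor

end CokernelBundles

/-! ### Lifting, matrices of morphisms, and the cokernel functor -/

namespace CokernelBundles

section Lifting

variable {C : Type 1} [Category.{0} C] [Abelian C]

/-- By the long exact sequence, the obstruction to lifting lies in `Ext¹(M, S.X₁)`. -/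
theorem exists_lift_of_ext_eq_zero [HasExt.{1} C] {S : ShortComplex C} (hS : S.ShortExact) {M : C}
    (h : Subsingleton (Abelian.Ext M S.X₁ 1)) (φ : M ⟶ S.X₃) : ∃ ψ : M ⟶ S.X₂, ψ ≫ S.g = φ := by
  obtain ⟨y, hy⟩ := Abelian.Ext.covariant_sequence_exact₃ M hS (Abelian.Ext.mk₀ φ) (zero_add 1)
    (Subsingleton.elim _ _)
  obtain ⟨ψ, rfl⟩ := (Abelian.Ext.mk₀_bijective _ _).2 y
  rw [Abelian.Ext.mk₀_comp_mk₀] at hy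
  exact ⟨ψ, (Abelian.Ext.mk₀_bijective _ _).1 hy⟩

end Lifting

variable {n : ℕ} {E F : (PSpace n).Modules} {rE rF : ℕ}

theorem power_hom_eq_zero (h : ∀ φ : F ⟶ E, φ = 0) {a b : ℕ} (φ : power F b ⟶ power E a) :
    φ = 0 :=
  biproduct.hom_ext' _ _ fun _ => biproduct.hom_ext _ _ fun _ => (h _).trans (h _).symm

/-- If `Ext¹(F, E) = 0`, morphisms from `F^b` lift along an epimorphism with kernel `E^a`. -/
theorem exists_lift_power (h : ExtOneVanishes F E) {a b : ℕ} {N C : (PSpace n).Modules}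
    {α : power E a ⟶ N} {π : N ⟶ C} {w : α ≫ π = 0} (hS : (ShortComplex.mk α π w).ShortExact)
    (φ : power F b ⟶ C) : ∃ ψ : power F b ⟶ N, ψ ≫ π = φ := by
  have : HasExt.{1} (PSpace n).Modules := HasExt.standard _
  have h0 : Subsingleton (Abelian.Ext F E 1) := h
  have h1 : Subsingleton (Abelian.Ext F (power E a) 1) :=
    (Abelian.Ext.addEquivBiproduct F (biproduct.isBilimit fun _ : Fin a => E) 1).subsingleton
  choose ψ hψ using fun j => exists_lift_of_ext_eq_zero hS h1 (biproduct.ι (fun _ => F) j ≫ φ)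
  refine ⟨biproduct.desc ψ, biproduct.hom_ext' _ _ fun j => ?_⟩
  rw [← Category.assoc, biproduct.ι_desc]
  exact hψ j

section Matrices

variable {V W : Type} [AddCommGroup V] [Module ℂ V] [FiniteDimensional ℂ V]
  [AddCommGroup W] [Module ℂ W] [FiniteDimensional ℂ W] {ι : Type} [Fintype ι]

theorem ι_sum_vtensorMap_π (σ : ι → (E ⟶ F)) (A : ι → V →ₗ[ℂ] W)
    (j : Fin (Module.finrank ℂ V)) (k : Fin (Module.finrank ℂ W)) :
    biproduct.ι (fun _ => E) j ≫ (∑ i, vtensorMap (A i) (σ i)) ≫ biproduct.π (fun _ => F) k =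
      ∑ i, LinearMap.toMatrix (Module.finBasis ℂ V) (Module.finBasis ℂ W) (A i) k j • σ i := by
  rw [Preadditive.sum_comp, Preadditive.comp_sum]
  refine Finset.sum_congr rfl fun i _ => ?_
  rw [vtensorMap, ← Category.assoc, biproduct.ι_matrix, biproduct.lift_π]

/-- Each matrix entry of the sum is the combination of the `σ i` whose coefficients are the
corresponding entries of the `A i`. -/
theorem sum_vtensorMap_injective (σ : Module.Basis ι ℂ (E ⟶ F)) {A B : ι → V →ₗ[ℂ] W}
    (h : ∑ i, vtensorMap (A i) (σ i) = ∑ i, vtensorMap (B i) (σ i)) : A = B := by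
  funext i
  refine (LinearMap.toMatrix (Module.finBasis ℂ V) (Module.finBasis ℂ W)).injective ?_
  ext k j
  have := congrArg (fun φ => biproduct.ι (fun _ => E) j ≫ φ ≫ biproduct.π (fun _ => F) k) h
  simp only [ι_sum_vtensorMap_π] at this
  have := congrArg (fun φ => σ.repr φ i) this
  simpa only [σ.repr_sum_self] using this

theorem exists_sum_vtensorMap_eq (σ : Module.Basis ι ℂ (E ⟶ F))
    (φ : vtensor V E ⟶ vtensor W F) :
    ∃ A : ι → V →ₗ[ℂ] W, ∑ i, vtensorMap (A i) (σ i) = φ := by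
  refine ⟨fun i => (LinearMap.toMatrix (Module.finBasis ℂ V) (Module.finBasis ℂ W)).symm
    (Matrix.of fun k j =>
      σ.repr (biproduct.ι (fun _ => E) j ≫ φ ≫ biproduct.π (fun _ => F) k) i), ?_⟩
  refine biproduct.hom_ext' _ _ fun j => biproduct.hom_ext _ _ fun k => ?_
  rw [Category.assoc, Category.assoc, ι_sum_vtensorMap_π]
  simp only [LinearEquiv.apply_symm_apply, Matrix.of_apply]
  exact σ.sum_repr _

theorem id_ne_zero_of_finrank (hE : Module.finrank ℂ (E ⟶ E) = 1) : 𝟙 E ≠ 0 := fun h => by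
  have : Subsingleton (E ⟶ E) :=
    ⟨fun f g => by rw [← Category.comp_id f, ← Category.comp_id g, h, comp_zero, comp_zero]⟩
  rw [Module.finrank_zero_of_subsingleton] at hE
  exact zero_ne_one hE

/-- Apply the matrix description to the one-element basis `𝟙 E` of `E ⟶ E`. -/
theorem vtensorMap_id_bijective (hE : Module.finrank ℂ (E ⟶ E) = 1) :
    Function.Bijective fun f : V →ₗ[ℂ] W => vtensorMap f (𝟙 E) := by
  let τ := FiniteDimensional.basisSingleton Unit hE (𝟙 E) (id_ne_zero_of_finrank hE)
  have hτ (A : Unit → V →ₗ[ℂ] W) : ∑ i, vtensorMap (A i) (τ i) = vtensorMap (A ()) (𝟙 E) := by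
    rw [Fintype.sum_unique, FiniteDimensional.basisSingleton_apply]
  refine ⟨fun f g h => ?_, fun φ => ?_⟩
  · exact congrFun (sum_vtensorMap_injective τ (A := fun _ => f) (B := fun _ => g)
      (by rw [hτ, hτ]; exact h)) ()
  · obtain ⟨A, hA⟩ := exists_sum_vtensorMap_eq τ φ
    exact ⟨A (), (hτ A).symm.trans hA⟩

end Matrices

section Functor

variable {w : ℕ} (σ : Module.Basis (Fin w) ℂ (E ⟶ F))

theorem mono_alpha (hE : IsVectorBundle E rE) (hF : IsVectorBundle F rF) {A : KroneckerRep w}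
    (hA : isGloballyInjective σ A) : Mono (alpha σ A) :=
  mono_of_fibreMap_injective hE hF _ ((isGloballyInjective_iff σ A).1 hA)

/-- The projection `W ⊗ F ⟶ coker (∑ i, A_i ⊗ σ_i)`. -/
def toCokernel (A : KroneckerRep w) : vtensor A.W F ⟶ (cokernelFunctor σ).obj A :=
  cokernel.π (alpha σ A)

instance (A : KroneckerRep w) : Epi (toCokernel σ A) := inferInstanceAs (Epi (cokernel.π _))

theorem alpha_toCokernel (A : KroneckerRep w) : alpha σ A ≫ toCokernel σ A = 0 :=
  cokernel.condition _

theorem shortExact_alpha {A : KroneckerRep w} (h : Mono (alpha σ A)) :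
    (ShortComplex.mk (alpha σ A) (toCokernel σ A) (alpha_toCokernel σ A)).ShortExact where
  exact := ShortComplex.exact_cokernel _
  mono_f := h
  epi_g := inferInstanceAs (Epi (toCokernel σ A))

theorem toCokernel_map {A B : KroneckerRep w} (f : A ⟶ B) :
    toCokernel σ A ≫ (cokernelFunctor σ).map f = vtensorMap f.right (𝟙 F) ≫ toCokernel σ B :=
  cokernel.π_desc _ _ _

theorem cokernelFunctor_map_bijective (hEF : IsAdmissiblePair E F rE rF) {A B : KroneckerRep w}
    (hB : isGloballyInjective σ B) :
    Function.Bijective fun f : A ⟶ B => (cokernelFunctor σ).map f := by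
  have hm := mono_alpha σ hEF.bundle_left hEF.bundle_right hB
  have hS := shortExact_alpha σ hm
  constructor
  · intro f g hfg
    -- The difference factors through `alpha σ B` by a map from a power of `F` to a power of `E`,
    -- which is zero.
    have h1 : (vtensorMap f.right (𝟙 F) - vtensorMap g.right (𝟙 F)) ≫ toCokernel σ B = 0 := by
      rw [Preadditive.sub_comp, ← toCokernel_map, ← toCokernel_map, sub_eq_zero]
      exact congrArg _ hfg
    have h2 : hS.exact.lift _ h1 ≫ alpha σ B = _ := hS.exact.lift_f _ h1
    rw [power_hom_eq_zero hEF.hom_eq_zero (hS.exact.lift _ h1), zero_comp, eq_comm,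
      sub_eq_zero] at h2
    have h3 : vtensorMap f.left (𝟙 E) = vtensorMap g.left (𝟙 E) := by
      rw [← cancel_mono (alpha σ B), ← alpha_comm, ← alpha_comm, h2]
    exact KroneckerRep.Hom.ext ((vtensorMap_id_bijective hEF.simple_left).1 h3)
      ((vtensorMap_id_bijective hEF.simple_right).1 h2)
  · intro φ
    obtain ⟨ψ, hψ⟩ := exists_lift_power hEF.ext_eq_zero hS (toCokernel σ A ≫ φ)
    obtain ⟨g, rfl⟩ := (vtensorMap_id_bijective (V := A.W) (W := B.W) hEF.simple_right).2 ψ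
    -- Hence the lift carries the image of `alpha σ A` into the kernel `V_B ⊗ E`, which produces
    -- `f`.
    have h1 : (alpha σ A ≫ vtensorMap g (𝟙 F)) ≫ toCokernel σ B = 0 := by
      rw [Category.assoc]
      refine (congrArg _ hψ).trans ?_
      rw [← Category.assoc, alpha_toCokernel, zero_comp]
    obtain ⟨f, hf⟩ := (vtensorMap_id_bijective (V := A.V) (W := B.V) hEF.simple_left).2
      (hS.exact.lift _ h1)
    have h2 : vtensorMap f (𝟙 E) ≫ alpha σ B = alpha σ A ≫ vtensorMap g (𝟙 F) :=
      (congrArg (· ≫ alpha σ B) hf).trans (hS.exact.lift_f _ h1)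
    -- Comparing coefficients of the `σ i` turns the one commuting square of sheaves into the `w`
    -- relations for the arrows.
    have h3 : (fun i => B.map i ∘ₗ f) = fun i => g ∘ₗ A.map i := by
      refine sum_vtensorMap_injective σ ?_
      simpa only [alpha, Preadditive.sum_comp, Preadditive.comp_sum, vtensorMap_comp,
        Category.comp_id, Category.id_comp] using h2
    let f' : A ⟶ B := ⟨f, g, fun i => (congrFun h3 i).symm⟩
    exact ⟨f', (cancel_epi (toCokernel σ A)).1 ((toCokernel_map σ f').trans hψ)⟩

theorem isVectorBundle_cokernelFunctor (hEF : IsAdmissiblePair E F rE rF) {A : KroneckerRep w}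
    (hA : isGloballyInjective σ A) : ∃ r, IsVectorBundle ((cokernelFunctor σ).obj A) r :=
  ⟨_, isVectorBundle_cokernel hEF.bundle_left hEF.bundle_right _
    ((isGloballyInjective_iff σ A).1 hA)⟩

theorem hasResolution_cokernelFunctor (hEF : IsAdmissiblePair E F rE rF) {A : KroneckerRep w}
    (hA : isGloballyInjective σ A) : HasResolution E F ((cokernelFunctor σ).obj A)
      (Module.finrank ℂ A.V) (Module.finrank ℂ A.W) :=
  ⟨_, _, _, shortExact_alpha σ (mono_alpha σ hEF.bundle_left hEF.bundle_right hA)⟩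

theorem exists_cokernelFunctor_iso (hEF : IsAdmissiblePair E F rE rF) {C : (PSpace n).Modules}
    {r a b : ℕ} (hC : IsVectorBundle C r) (h : HasResolution E F C a b) :
    ∃ A : KroneckerRep w, isGloballyInjective σ A ∧ Module.finrank ℂ A.V = a ∧
      Module.finrank ℂ A.W = b ∧ Nonempty ((cokernelFunctor σ).obj A ≅ C) := by
  -- This turns `power E a` and `power F b` into `vtensor` of coordinate spaces, so that `α` becomes
  -- a sum `∑ A_i ⊗ σ_i`.
  rw [← Module.finrank_fin_fun (R := ℂ) (n := a), ← Module.finrank_fin_fun (R := ℂ) (n := b)] at h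
  obtain ⟨α, π, w, hS⟩ := h
  obtain ⟨f, rfl⟩ := exists_sum_vtensorMap_eq (V := Fin a → ℂ) (W := Fin b → ℂ) σ α
  let A : KroneckerRep _ := { V := Fin a → ℂ, W := Fin b → ℂ, map := f }
  refine ⟨A, (isGloballyInjective_iff σ A).2 fun P _ => ?_, Module.finrank_fin_fun ℂ,
    Module.finrank_fin_fun ℂ, ⟨?_⟩⟩
  · obtain ⟨U, e, hPU, he⟩ := hEF.bundle_left.exists_isFrame P
    obtain ⟨V, c, hPV, hc⟩ := hC.exists_isFrame P
    exact fibreMap_injective_of_shortExact hS P hPU hPV (he.power _) hc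
  · exact IsColimit.coconePointUniqueUpToIso (cokernelIsCokernel (alpha σ A)) hS.gIsCokernel

end Functor

/-- Both subcategories are full, so the equivalence reduces to properties of `G` on objects
satisfying `P`; this serves (a) and (b) alike. -/
theorem isEquivalence_lift {C : Type*} [Category C] {D : Type*} [Category D] (P : ObjectProperty C)
    (Q : ObjectProperty D) (G : C ⥤ D) (h : ∀ A : P.FullSubcategory, Q ((P.ι ⋙ G).obj A))
    (hG : ∀ A B, P A → P B → Function.Bijective fun f : A ⟶ B => G.map f)
    (hs : ∀ Y, Q Y → ∃ A, P A ∧ Nonempty (G.obj A ≅ Y)) :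
    (Q.lift (P.ι ⋙ G) h).IsEquivalence := by
  have h1 : (P.ι ⋙ G).Faithful :=
    ⟨fun {A B} f g hfg => P.ι.map_injective ((hG _ _ A.2 B.2).1 hfg)⟩
  have h2 : (P.ι ⋙ G).Full := ⟨fun {A B} φ => by
    obtain ⟨f, hf⟩ := (hG _ _ A.2 B.2).2 φ
    obtain ⟨f', rfl⟩ := P.ι.map_surjective f
    exact ⟨f', hf⟩⟩
  have h3 : (Q.lift (P.ι ⋙ G) h).EssSurj := ⟨fun Y => by
    obtain ⟨A, hA, ⟨φ⟩⟩ := hs Y.1 Y.2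
    exact ⟨⟨A, hA⟩, ⟨Q.ι.preimageIso φ⟩⟩⟩
  exact { }

end CokernelBundles

end

/-! ### The two equivalences -/

theorem mainTheorem5 (n : ℕ) (hn : 2 ≤ n)
    (E F : (CokernelBundles.PSpace n).Modules) (rE rF : ℕ)
    (hEF : CokernelBundles.IsAdmissiblePair E F rE rF)
    (w : ℕ) (σ : Module.Basis (Fin w) ℂ (E ⟶ F)) :
    (∃ h : ∀ A : (CokernelBundles.isGloballyInjective σ).FullSubcategory,
        CokernelBundles.isResolvedBundle E F
          (((CokernelBundles.isGloballyInjective σ).ι ⋙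
            CokernelBundles.cokernelFunctor σ).obj A),
      ((CokernelBundles.isResolvedBundle E F).lift
        ((CokernelBundles.isGloballyInjective σ).ι ⋙
          CokernelBundles.cokernelFunctor σ) h).IsEquivalence) ∧
    (∃ h : ∀ A : (CokernelBundles.isGloballyInjectiveOfRank rE rF σ).FullSubcategory,
        CokernelBundles.isCokernelBundle E F rE rF
          (((CokernelBundles.isGloballyInjectiveOfRank rE rF σ).ι ⋙
            CokernelBundles.cokernelFunctor σ).obj A),
      ((CokernelBundles.isCokernelBundle E F rE rF).lift
        ((CokernelBundles.isGloballyInjectiveOfRank rE rF σ).ι ⋙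
          CokernelBundles.cokernelFunctor σ) h).IsEquivalence) := by
  refine ⟨⟨fun A => ?_, ?_⟩, ⟨fun A => ?_, ?_⟩⟩
  · exact ⟨CokernelBundles.isVectorBundle_cokernelFunctor σ hEF A.2, _, _,
      CokernelBundles.hasResolution_cokernelFunctor σ hEF A.2⟩
  · refine CokernelBundles.isEquivalence_lift _ _ _ _
      (fun A B _ hB => CokernelBundles.cokernelFunctor_map_bijective σ hEF hB) ?_
    rintro C ⟨⟨r, hC⟩, a, b, h⟩
    obtain ⟨A, hA, -, -, hAC⟩ := CokernelBundles.exists_cokernelFunctor_iso σ hEF hC h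
    exact ⟨A, hA, hAC⟩
  · exact ⟨CokernelBundles.isVectorBundle_cokernelFunctor σ hEF A.2.1, _, _,
      CokernelBundles.hasResolution_cokernelFunctor σ hEF A.2.1, A.2.2⟩
  · refine CokernelBundles.isEquivalence_lift _ _ _ _
      (fun A B _ hB => CokernelBundles.cokernelFunctor_map_bijective σ hEF hB.1) ?_
    rintro C ⟨⟨r, hC⟩, a, b, h, hab⟩
    -- With `a = dim V` and `b = dim W`, the rank inequality for the resolution is that for the
    -- representation.
    obtain ⟨A, hA, rfl, rfl, hAC⟩ := CokernelBundles.exists_cokernelFunctor_iso σ hEF hC h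
    exact ⟨A, ⟨hA, hab⟩, hAC⟩
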